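/- Notation. Let $n\ge 1$ be an integer, let $\mathbb{D}=\{z\in\mathbb{C}:|z|<1\}$, $\overline{\mathbb{D}}=\{z\in\mathbb{C}:|z|\le 1\}$, $\mathbb{T}=\{z\in\mathbb{C}:|z|=1\}$, and let $0<\lambda<\frac{2\pi}{n}$. Let $\pi_n(\overline{\mathbb{D}})$ be the set of complex polynomials of degree $n$ all of whose zeros lie in $\overline{\mathbb{D}}$. For a polynomial $F(z)=\sum_{k=0}^n a_kz^k$ put $F_+(z)=F(e^{i\lambda/2}z)$, $F_-(z)=F(e^{-i\lambda/2}z)$, and $F^{*n}(z)=z^n\overline{F(1/\overline{z})}=\sum_{k=0}^n\overline{a_{n-k}}\,z^k$. Let $\overline{\mathcal{T}}_n(\lambda)$ (resp. $\mathcal{T}_n(\lambda)$) be the set of polynomials of degree $n$ all of whose zeros lie on $\mathbb{T}$ and such that each pair of zeros (counted with multiplicity) is separated by an angle $\ge\lambda$ (resp. $>\lambda$). Let $\overline{\mathcal{D}}_n(\lambda)$ be the set of polynomials $F$ of degree $n$ for which $$\operatorname{Im}\Bigl(e^{-in\lambda/2}\,\frac{F_+(z)}{F_-(z)}\Bigr)>0$$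 for all $z\in\mathbb{C}\setminus\overline{\mathbb{D}}$, and let $\mathcal{D}_n(\lambda)$ be the union of $\mathcal{T}_n(\lambda)$ with the set of polynomials $F$ of degree $n$ for which this inequality holds for all $z\in\mathbb{C}\setminus\mathbb{D}$ (in particular the quotient has no poles there). Theorem. Let $\lambda\in(0,\frac{2\pi}{n})$ and $F\in\pi_n(\overline{\mathbb{D}})$. Then 1. $F\in\overline{\mathcal{D}}_n(\lambda)\setminus\overline{\mathcal{T}}_n(\lambda)$ if, and only if, $F+\zeta F^{*n}\in\overline{\mathcal{T}}_n(\lambda)$ for all $\zeta\in\mathbb{T}$. 2. $F\in\mathcal{D}_n(\lambda)\setminus\mathcal{T}_n(\lambda)$ if, and only if, $F+\zeta F^{*n}\in\mathcal{T}_n(\lambda)$ for all $\zeta\in\mathbb{T}$. 3. If $F\in\overline{\mathcal{D}}_n(\lambda)\setminus\overline{\mathcal{T}}_n(\lambda)$ and if $z_0\in\mathbb{T}$ and $x\in\mathbb{R}$ are such that $e^{-in\lambda/2}\frac{F_+(z_0)}{F_-(z_0)}=x$, then $$\lim_{z\to z_0}e^{-in\lambda/2}\,\frac{(F+\zeta F^{*n})_+(z)}{(F+\zeta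 F^{*n})_-(z)}=x\qquad\text{for all }\zeta\in\mathbb{T}.$$ -/

import Mathlib

open Polynomial Filter Topology

/-- `π_n(Ω)`: the complex polynomials of degree (exactly) `n` all of whose zeros lie in `Ω`. -/
def zerosIn (n : ℕ) (Ω : Set ℂ) : Set ℂ[X] :=
  {F | F.degree = n ∧ ∀ z : ℂ, F.IsRoot z → z ∈ Ω}

/-- `closed-T_n(lam)`: polynomials of degree `n` with zeros only on the unit circle, each pair of
zeros being separated by an angle of at least `lam`. Zeros are counted with multiplicity: a pair
is a two-element sub-multiset of the multiset of zeros, so a multiple zero is a pair of zeros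
separated by the angle `0`. -/
def closedT (n : ℕ) (lam : ℝ) : Set ℂ[X] :=
  {F | F ∈ zerosIn n (Metric.sphere 0 1) ∧
    ∀ z w : ℂ, ({z, w} : Multiset ℂ) ≤ F.roots → lam ≤ |Complex.arg (z / w)|}

/-- `T_n(lam)`: as `closedT`, with each pair of zeros separated by an angle `> lam`. -/
def openT (n : ℕ) (lam : ℝ) : Set ℂ[X] :=
  {F | F ∈ zerosIn n (Metric.sphere 0 1) ∧
    ∀ z w : ℂ, ({z, w} : Multiset ℂ) ≤ F.roots → lam < |Complex.arg (z / w)|}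

/-- `F_+(z) = F(e^{i lam/2} z)`. -/
noncomputable def shiftPlus (lam : ℝ) (F : ℂ[X]) (z : ℂ) : ℂ :=
  F.eval (Complex.exp (Complex.I * lam / 2) * z)

/-- `F_-(z) = F(e^{-i lam/2} z)`. -/
noncomputable def shiftMinus (lam : ℝ) (F : ℂ[X]) (z : ℂ) : ℂ :=
  F.eval (Complex.exp (-(Complex.I * lam / 2)) * z)

/-- The function `e^{-i n lam/2} F_+(z) / F_-(z)`. -/
noncomputable def shiftQuotient (n : ℕ) (lam : ℝ) (F : ℂ[X]) (z : ℂ) : ℂ :=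
  Complex.exp (-(Complex.I * n * lam / 2)) * (shiftPlus lam F z / shiftMinus lam F z)

/-- `closed-D_n(lam)`, for `0 < lam < 2π/n`: polynomials `F` of degree `n` with
`Im (e^{-i n lam/2} F_+(z) / F_-(z)) > 0` for all `|z| > 1`. (Where `F_-(z) = 0` the quotient is
`0` by convention, so the strict inequality excludes poles.) -/
def closedD (n : ℕ) (lam : ℝ) : Set ℂ[X] :=
  {F | F.degree = n ∧ ∀ z : ℂ, 1 < ‖z‖ → 0 < (shiftQuotient n lam F z).im}

/-- `D_n(lam)`, for `0 < lam < 2π/n`: the union of `T_n(lam)` with the set of polynomials `F` of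
degree `n` such that `Im (e^{-i n lam/2} F_+(z) / F_-(z)) > 0` for all `|z| ≥ 1`. -/
def openD (n : ℕ) (lam : ℝ) : Set ℂ[X] :=
  openT n lam ∪
    {F | F.degree = n ∧ ∀ z : ℂ, 1 ≤ ‖z‖ → 0 < (shiftQuotient n lam F z).im}

/-- The `n`-inverse `F^{*n}` of a polynomial `F = ∑ a_k z^k` of degree at most `n`:
`F^{*n}(z) = ∑ conj(a_{n-k}) z^k`, summed over `0 ≤ k ≤ n`. -/
noncomputable def nInverse (n : ℕ) (F : ℂ[X]) : ℂ[X] :=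
  ∑ k ∈ Finset.range (n + 1), C (starRingEnd ℂ (F.coeff (n - k))) * X ^ k

/-- The `n`-inverse satisfies `F^{*n}(z) = z^n conj(F(1 / conj z))`. -/
theorem nInverse_eval (n : ℕ) (F : ℂ[X]) (hF : F.degree ≤ n) (z : ℂ) (hz : z ≠ 0) :
    (nInverse n F).eval z =
      z ^ n * starRingEnd ℂ (F.eval (1 / starRingEnd ℂ z)) := by
  have hd : F.natDegree < n + 1 := Nat.lt_succ_of_le (natDegree_le_iff_degree_le.mpr hF)
  rw [eval_eq_sum_range' hd, map_sum, Finset.mul_sum, nInverse, eval_finsetSum,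
    ← Finset.sum_range_reflect]
  refine Finset.sum_congr rfl fun k hk => ?_
  have hk' : k ≤ n := Nat.lt_succ_iff.mp (Finset.mem_range.mp hk)
  have h1 : n + 1 - 1 - k = n - k := by omega
  have h2 : n - (n - k) = k := by omega
  have h3 : z ^ n = z ^ (n - k) * z ^ k := by rw [← pow_add]; congr 1; omega
  have h4 : (1 / z) ^ k * z ^ k = 1 := by rw [← mul_pow, one_div_mul_cancel hz, one_pow]
  simp only [h1, h2, eval_mul, eval_C, eval_pow, eval_X, map_mul, map_pow, map_div₀, map_one,
    Complex.conj_conj, h3]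
  linear_combination (-(starRingEnd ℂ (F.coeff k)) * z ^ (n - k)) * h4

/-!
The proof reduces all three claims to one real function, the phase of `F` on the unit circle.

Suppose first that all zeros `a` of `F` lie in the open disk. Then
`ψ(θ) = ∑ (θ + 2 arg (1 - a e^{-iθ}))` (`rootPhase F 1`) is a continuous, strictly increasing
argument of the Blaschke product `F / F^{*n}`, up to a constant, with
`ψ(θ + 2π) = ψ(θ) + 2πn`. It governs both sides of the equivalences.

* The zeros of a member `F + ζ F^{*n}` of the pencil are the points `e^{iθ}` where `ψ` takes a
  prescribed value modulo `2π` (`pencil_eval_exp_eq_zero_iff`, `pencil_roots`). Hence all pencil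
  members have zeros separated by at least (more than) `lam` if and only if
  `ψ(θ + lam) - ψ(θ)` is always at most (less than) `2π` (`rootPhase_sub_le_iff_pencil`,
  `rootPhase_sub_lt_iff_pencil`).
* The shift quotient at `e^{iθ}` has argument `(ψ(θ + lam/2) - ψ(θ - lam/2)) / 2`
  (`shiftQuotient_circle`), so the same bound on increments says that its imaginary part is
  nonnegative (positive) on the circle. The assumption `n * lam < 2π` excludes increments that
  exceed `2π` everywhere (`rootPhase_sub_lt_of_im_pos`), and the maximum principle carries the sign
  to the exterior of the disk (`im_shiftQuotient_pos_of_nonneg`).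

Zeros on the unit circle are dealt with separately. If `F` has one, then some pencil member has a
double zero there (`rootsInBall_one_of_pencil`). On the other side, if `F` belongs to `closedD`,
the analogous phases on the circles of radius `ρ > 1` have increments below `2π`, and the limit
`ρ → 1` shows that a zero on the circle forces `F` into `closedT` (`mem_closedT_of_mem_closedD`).

For the boundary values let `f(θ)` be the shift quotient of `F` at `e^{iθ}`. Since `Im f ≥ 0`, the
derivative of `f` is real where `f` is. Writing the shift quotient of `H = F + ζ F^{*n}` as
`x + D / H_-` with `D = e^{-i n lam/2} H_+ - x H_-`, one finds that `D` vanishes at `z₀`, to second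
order if `H_-` vanishes there; as the zeros of `H` are simple, `D / H_-` tends to `0`
(`tendsto_shiftQuotient_pencil`).
-/

/-! ### The phase of a single linear factor -/

/-- A continuous argument of the Blaschke factor `(z - a) / (1 - conj a * z)` at `z = e^{iθ}`, for
`|a| < 1`. The formula stays meaningful for `|a| = 1` as long as `e^{iθ} ≠ a`. -/
noncomputable def blaschkePhase (a : ℂ) (θ : ℝ) : ℝ :=
  θ + 2 * Complex.arg (1 - a * Complex.exp (-(θ * Complex.I)))

theorem norm_exp_neg_mul_I (θ : ℝ) : ‖Complex.exp (-(θ * Complex.I))‖ = 1 := by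
  rw [← neg_mul, ← Complex.ofReal_neg, Complex.norm_exp_ofReal_mul_I]

theorem one_sub_mem_slitPlane {u : ℂ} (hu : ‖u‖ ≤ 1) (h1 : u ≠ 1) :
    1 - u ∈ Complex.slitPlane := by
  rw [Complex.mem_slitPlane_iff]
  by_contra! h
  have hre : 1 ≤ u.re := by simpa using h.1
  have him : u.im = 0 := by simpa using h.2
  have hle := (Complex.re_le_norm u).trans hu
  exact h1 (Complex.ext (by simpa using le_antisymm hle hre) (by simpa using him))

theorem one_sub_mul_exp_mem_slitPlane {a : ℂ} {θ : ℝ} (ha : ‖a‖ ≤ 1)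
    (hne : Complex.exp (θ * Complex.I) ≠ a) :
    1 - a * Complex.exp (-(θ * Complex.I)) ∈ Complex.slitPlane := by
  refine one_sub_mem_slitPlane (by simpa [norm_exp_neg_mul_I] using ha) fun h => hne ?_
  rw [Complex.exp_neg, ← div_eq_mul_inv, div_eq_one_iff_eq (Complex.exp_ne_zero _)] at h
  exact h.symm

theorem exp_mul_I_ne_of_norm_lt {a : ℂ} (ha : ‖a‖ < 1) (θ : ℝ) :
    Complex.exp (θ * Complex.I) ≠ a := fun h => by
  rw [← h, Complex.norm_exp_ofReal_mul_I] at ha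
  exact lt_irrefl _ ha

theorem one_add_two_mul_re_pos {w : ℂ} (hw : ‖w‖ < 1) : 0 < 1 + 2 * (w / (1 - w)).re := by
  have h1 : (1 : ℂ) - w ≠ 0 := fun h => by
    rw [← sub_eq_zero.mp h] at hw; simp at hw
  have hpos : 0 < Complex.normSq (1 - w) := Complex.normSq_pos.mpr h1
  have hlt : Complex.normSq w < 1 := by
    rw [Complex.normSq_eq_norm_sq]; nlinarith [norm_nonneg w]
  have key : 1 + 2 * (w / (1 - w)).re = (1 - Complex.normSq w) / Complex.normSq (1 - w) := by
    rw [Complex.div_re, eq_div_iff hpos.ne', add_mul, mul_add, add_mul]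
    field_simp
    simp only [Complex.normSq_apply, Complex.sub_re, Complex.sub_im, Complex.one_re,
      Complex.one_im]
    ring
  rw [key]
  exact div_pos (by linarith) hpos

theorem hasDerivAt_blaschkePhase {a : ℂ} (ha : ‖a‖ < 1) (θ : ℝ) :
    HasDerivAt (blaschkePhase a) (1 + 2 * (a * Complex.exp (-(θ * Complex.I)) /
      (1 - a * Complex.exp (-(θ * Complex.I)))).re) θ := by
  have hofReal : HasDerivAt (fun t : ℝ => -((t : ℂ) * Complex.I)) (-(1 * Complex.I)) θ :=
    (Complex.ofRealCLM.hasDerivAt.mul_const Complex.I).neg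
  have hlog := ((hofReal.cexp.const_mul a).const_sub 1).clog_real
    (one_sub_mul_exp_mem_slitPlane ha.le (exp_mul_I_ne_of_norm_lt ha θ))
  have him := Complex.imCLM.hasFDerivAt.comp_hasDerivAt θ hlog
  have hphase := (hasDerivAt_id θ).add (him.const_mul 2)
  have hfun : blaschkePhase a = id + fun t : ℝ => 2 * (Complex.imCLM ∘ fun t : ℝ =>
      Complex.log (1 - a * Complex.exp (-(t * Complex.I)))) t := by
    funext t
    simp [blaschkePhase, Complex.log_im]
  rw [hfun]
  refine hphase.congr_deriv ?_
  rw [show ∀ u v : ℂ, -(a * (u * -(1 * Complex.I))) / v = a * u / v * Complex.I from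
    fun u v => by ring]
  simp

theorem continuous_blaschkePhase {a : ℂ} (ha : ‖a‖ < 1) : Continuous (blaschkePhase a) :=
  continuous_iff_continuousAt.mpr fun θ => (hasDerivAt_blaschkePhase ha θ).continuousAt

theorem strictMono_blaschkePhase {a : ℂ} (ha : ‖a‖ < 1) : StrictMono (blaschkePhase a) :=
  strictMono_of_deriv_pos fun θ => by
    rw [(hasDerivAt_blaschkePhase ha θ).deriv]
    exact one_add_two_mul_re_pos (by simpa [norm_exp_neg_mul_I] using ha)

theorem blaschkePhase_add_two_pi (a : ℂ) (θ : ℝ) :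
    blaschkePhase a (θ + 2 * Real.pi) = blaschkePhase a θ + 2 * Real.pi := by
  have : Complex.exp (-(((θ + 2 * Real.pi : ℝ) : ℂ) * Complex.I)) =
      Complex.exp (-(θ * Complex.I)) := by
    rw [Complex.exp_eq_exp_iff_exists_int]
    exact ⟨-1, by push_cast; ring⟩
  rw [blaschkePhase, blaschkePhase, this]
  ring

theorem exp_ofReal_mul_I_ne {α θ : ℝ} (hne : θ ≠ α) (h : |θ - α| < 2 * Real.pi) :
    Complex.exp (θ * Complex.I) ≠ Complex.exp (α * Complex.I) := fun he => by
  obtain ⟨k, hk⟩ := Complex.exp_eq_exp_iff_exists_int.mp he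
  have hk' : θ = α + k * (2 * Real.pi) := by
    have := congrArg Complex.im hk
    simpa using this
  have hk0 : k ≠ 0 := by rintro rfl; simp at hk'; exact hne hk'
  have h1 : (1 : ℝ) ≤ |(k : ℝ)| := by exact_mod_cast Int.one_le_abs hk0
  rw [hk', add_sub_cancel_left, abs_mul, abs_of_pos Real.two_pi_pos] at h
  nlinarith [Real.two_pi_pos]

theorem blaschkePhase_exp_of_pos {α t : ℝ} (h0 : 0 < t) (h1 : t < 2 * Real.pi) :
    blaschkePhase (Complex.exp (α * Complex.I)) (α + t) = α + Real.pi := by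
  have hsin : 0 < Real.sin (t / 2) := Real.sin_pos_of_pos_of_lt_pi (by linarith) (by linarith)
  have key : 1 - Complex.exp (α * Complex.I) * Complex.exp (-(((α + t : ℝ) : ℂ) * Complex.I)) =
      ((2 * Real.sin (t / 2) : ℝ) : ℂ) * (Complex.cos (((Real.pi - t) / 2 : ℝ) : ℂ) +
        Complex.sin (((Real.pi - t) / 2 : ℝ) : ℂ) * Complex.I) := by
    have e1 : (Real.pi - t) / 2 = Real.pi / 2 - t / 2 := by ring
    have e2 : (α : ℂ) * Complex.I + -(((α + t : ℝ) : ℂ) * Complex.I) =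
        ((-(2 * (t / 2)) : ℝ) : ℂ) * Complex.I := by push_cast; ring
    rw [← Complex.exp_add, e2, Complex.exp_mul_I, ← Complex.ofReal_cos, ← Complex.ofReal_sin,
      ← Complex.ofReal_cos, ← Complex.ofReal_sin, e1, Real.cos_pi_div_two_sub,
      Real.sin_pi_div_two_sub, Real.cos_neg, Real.sin_neg, Real.cos_two_mul, Real.sin_two_mul]
    have hsq := Real.sin_sq_add_cos_sq (t / 2)
    apply Complex.ext
    · simp only [Complex.sub_re, Complex.one_re, Complex.add_re, Complex.mul_re,
        Complex.ofReal_re, Complex.ofReal_im, Complex.I_re, Complex.I_im, Complex.add_im,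
        Complex.mul_im]
      nlinarith
    · simp only [Complex.sub_im, Complex.one_im, Complex.add_re, Complex.mul_re,
        Complex.ofReal_re, Complex.ofReal_im, Complex.I_re, Complex.I_im, Complex.add_im,
        Complex.mul_im]
      ring
  rw [blaschkePhase, key, Complex.arg_mul_cos_add_sin_mul_I (by linarith)
    ⟨by linarith, by linarith⟩]
  ring

/-- The phase attached to a point of the unit circle jumps by `2π` there and is constant
elsewhere. -/
theorem blaschkePhase_exp_sub {α θ₁ θ₂ : ℝ} (h1 : α - 2 * Real.pi < θ₁) (h2 : θ₁ < α)
    (h3 : α < θ₂) (h4 : θ₂ < α + 2 * Real.pi) :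
    blaschkePhase (Complex.exp (α * Complex.I)) θ₂ -
      blaschkePhase (Complex.exp (α * Complex.I)) θ₁ = 2 * Real.pi := by
  have e2 := blaschkePhase_exp_of_pos (α := α) (t := θ₂ - α) (by linarith) (by linarith)
  have e1 := blaschkePhase_exp_of_pos (α := α) (t := θ₁ + 2 * Real.pi - α) (by linarith)
    (by linarith)
  rw [add_sub_cancel] at e1 e2
  rw [blaschkePhase_add_two_pi] at e1
  linarith

theorem tendsto_blaschkePhase_div {a : ℂ} {θ : ℝ} (ha : ‖a‖ ≤ 1)
    (hne : Complex.exp (θ * Complex.I) ≠ a) :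
    Tendsto (fun ρ : ℝ => blaschkePhase (a / ρ) θ) (𝓝[>] 1) (𝓝 (blaschkePhase a θ)) := by
  have hc : ContinuousAt (fun ρ : ℝ => a / (ρ : ℂ)) 1 :=
    continuousAt_const.div Complex.continuous_ofReal.continuousAt (by simp)
  have hd : ContinuousAt (fun b : ℂ => blaschkePhase b θ) a := by
    unfold blaschkePhase
    refine continuousAt_const.add (continuousAt_const.mul ?_)
    exact (Complex.continuousAt_arg (one_sub_mul_exp_mem_slitPlane ha hne)).comp
      (f := fun b : ℂ => 1 - b * Complex.exp (-(θ * Complex.I))) (by fun_prop)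
  have : ContinuousAt (fun ρ : ℝ => blaschkePhase (a / ρ) θ) 1 :=
    ContinuousAt.comp (g := fun b : ℂ => blaschkePhase b θ) (by simpa using hd) hc
  have h := this.tendsto
  simp only [Complex.ofReal_one, div_one] at h
  exact h.mono_left nhdsWithin_le_nhds

theorem norm_div_lt_one {a : ℂ} {ρ : ℝ} (ha : ‖a‖ ≤ 1) (hρ : 1 < ρ) : ‖a / (ρ : ℂ)‖ < 1 := by
  rw [norm_div, Complex.norm_real, Real.norm_eq_abs, abs_of_pos (by linarith),
    div_lt_one (by linarith)]
  linarith

/-- Polar form of a linear factor on the circle of radius `ρ`. -/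
theorem sub_eq_norm_mul_exp_blaschkePhase (a : ℂ) {ρ : ℝ} (hρ : 0 < ρ) (θ : ℝ) :
    ρ * Complex.exp (θ * Complex.I) - a = ‖ρ * Complex.exp (θ * Complex.I) - a‖ *
      Complex.exp (((θ + blaschkePhase (a / ρ) θ) / 2 : ℝ) * Complex.I) := by
  have hρ' : (ρ : ℂ) ≠ 0 := by exact_mod_cast hρ.ne'
  set v := 1 - a / ρ * Complex.exp (-(θ * Complex.I)) with hv
  have e1 : ρ * Complex.exp (θ * Complex.I) - a = ρ * Complex.exp (θ * Complex.I) * v := by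
    rw [hv, Complex.exp_neg]
    field_simp
  have e2 : ‖ρ * Complex.exp (θ * Complex.I) - a‖ = ρ * ‖v‖ := by
    rw [e1, norm_mul, norm_mul, Complex.norm_exp_ofReal_mul_I, Complex.norm_real,
      Real.norm_of_nonneg hρ.le, mul_one]
  have e3 : (((θ + blaschkePhase (a / ρ) θ) / 2 : ℝ) : ℂ) * Complex.I =
      θ * Complex.I + v.arg * Complex.I := by
    rw [blaschkePhase, ← hv]; push_cast; ring
  rw [e2, e3, Complex.exp_add, e1]
  nth_rewrite 1 [← Complex.norm_mul_exp_arg_mul_I v]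
  push_cast
  ring

/-! ### The phase of a polynomial -/

/-- The sum of the phases of the rescaled zeros `a / ρ` of `F`. Up to a constant,
`(n * θ + rootPhase F ρ θ) / 2` is a continuous argument of `F (ρ e^{iθ})`. -/
noncomputable def rootPhase (F : ℂ[X]) (ρ θ : ℝ) : ℝ :=
  (F.roots.map fun a => blaschkePhase (a / ρ) θ).sum

/-- All zeros of `F` lie in the disk `|z| < ρ`, for `ρ > 0`. The condition is put in terms of the
rescaled zeros `a / ρ`, which are the parameters of the summands of `rootPhase F ρ`. -/
def RootsInBall (F : ℂ[X]) (ρ : ℝ) : Prop :=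
  ∀ a ∈ F.roots, ‖a / (ρ : ℂ)‖ < 1

theorem continuous_rootPhase {F : ℂ[X]} {ρ : ℝ} (h : RootsInBall F ρ) :
    Continuous (rootPhase F ρ) :=
  continuous_multiset_sum _ fun a ha => continuous_blaschkePhase (h a ha)

theorem card_roots_eq (F : ℂ[X]) : F.roots.card = F.natDegree :=
  (splits_iff_card_roots.mp (IsAlgClosed.splits F))

theorem strictMono_rootPhase {F : ℂ[X]} {ρ : ℝ} (h : RootsInBall F ρ) (hn : 0 < F.natDegree) :
    StrictMono (rootPhase F ρ) := fun s t hst => by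
  obtain ⟨a, ha⟩ := Multiset.card_pos_iff_exists_mem.mp ((card_roots_eq F).symm ▸ hn)
  exact Multiset.sum_lt_sum (fun b hb => (strictMono_blaschkePhase (h b hb)).monotone hst.le)
    ⟨a, ha, strictMono_blaschkePhase (h a ha) hst⟩

theorem rootPhase_add_two_pi (F : ℂ[X]) (ρ θ : ℝ) :
    rootPhase F ρ (θ + 2 * Real.pi) = rootPhase F ρ θ + F.natDegree * (2 * Real.pi) := by
  simp only [rootPhase, blaschkePhase_add_two_pi, Multiset.sum_map_add, Multiset.map_const',
    Multiset.sum_replicate, card_roots_eq, nsmul_eq_mul]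

theorem rootPhase_add_nat_mul_two_pi (F : ℂ[X]) (ρ θ : ℝ) (k : ℕ) :
    rootPhase F ρ (θ + k * (2 * Real.pi)) =
      rootPhase F ρ θ + k * (F.natDegree * (2 * Real.pi)) := by
  induction k with
  | zero => simp
  | succ k ih =>
    have : θ + ((k + 1 : ℕ) : ℝ) * (2 * Real.pi) = θ + k * (2 * Real.pi) + 2 * Real.pi := by
      push_cast; ring
    rw [this, rootPhase_add_two_pi, ih]
    push_cast; ring

theorem surjective_rootPhase {F : ℂ[X]} {ρ : ℝ} (h : RootsInBall F ρ) (hn : 0 < F.natDegree) :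
    Function.Surjective (rootPhase F ρ) := fun c => by
  have hn' : (1 : ℝ) ≤ F.natDegree := by exact_mod_cast hn
  have hpi := Real.pi_gt_three
  refine mem_range_of_exists_le_of_exists_ge (continuous_rootPhase h) ?_ ?_
  · obtain ⟨k, hk⟩ := exists_nat_ge (rootPhase F ρ 0 - c)
    refine ⟨-(k * (2 * Real.pi)), ?_⟩
    have := rootPhase_add_nat_mul_two_pi F ρ (-(k * (2 * Real.pi))) k
    rw [neg_add_cancel] at this
    have h1 : (k : ℝ) * 1 ≤ k * (F.natDegree * (2 * Real.pi)) := by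
      gcongr; nlinarith
    linarith
  · obtain ⟨k, hk⟩ := exists_nat_ge (c - rootPhase F ρ 0)
    refine ⟨0 + k * (2 * Real.pi), ?_⟩
    rw [rootPhase_add_nat_mul_two_pi]
    have h1 : (k : ℝ) * 1 ≤ k * (F.natDegree * (2 * Real.pi)) := by
      gcongr; nlinarith
    linarith

theorem eval_eq_leadingCoeff_mul_prod (F : ℂ[X]) (z : ℂ) :
    F.eval z = F.leadingCoeff * (F.roots.map fun a => z - a).prod := by
  conv_lhs => rw [(IsAlgClosed.splits F).eq_prod_roots]
  rw [eval_mul, eval_C, eval_multiset_prod, Multiset.map_map]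
  simp

/-- Polar form of `F` on the circle of radius `ρ`. -/
theorem eval_eq_norm_mul_exp_rootPhase (F : ℂ[X]) {ρ : ℝ} (hρ : 0 < ρ) (θ : ℝ) :
    F.eval (ρ * Complex.exp (θ * Complex.I)) =
      ‖F.eval (ρ * Complex.exp (θ * Complex.I))‖ * Complex.exp (F.leadingCoeff.arg * Complex.I) *
        Complex.exp (((F.natDegree * θ + rootPhase F ρ θ) / 2 : ℝ) * Complex.I) := by
  set z := ρ * Complex.exp (θ * Complex.I) with hz
  have key : ∀ s : Multiset ℂ, (s.map fun a => z - a).prod =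
      ‖(s.map fun a => z - a).prod‖ * Complex.exp (((s.card * θ +
        (s.map fun a => blaschkePhase (a / ρ) θ).sum) / 2 : ℝ) * Complex.I) := by
    intro s
    induction s using Multiset.induction_on with
    | empty => simp
    | cons a s ih =>
      rw [Multiset.map_cons, Multiset.prod_cons, Multiset.map_cons, Multiset.sum_cons, norm_mul,
        Multiset.card_cons]
      nth_rewrite 1 [ih]
      nth_rewrite 1 [hz, sub_eq_norm_mul_exp_blaschkePhase a hρ θ, ← hz]
      have : (((((s.card + 1 : ℕ) : ℝ) * θ + (blaschkePhase (a / ρ) θ +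
          (s.map fun a => blaschkePhase (a / ρ) θ).sum)) / 2 : ℝ) : ℂ) * Complex.I =
          (((θ + blaschkePhase (a / ρ) θ) / 2 : ℝ) : ℂ) * Complex.I +
          (((s.card * θ + (s.map fun a => blaschkePhase (a / ρ) θ).sum) / 2 : ℝ) : ℂ) *
            Complex.I := by
        push_cast; ring
      rw [this, Complex.exp_add]
      push_cast
      ring
  rw [eval_eq_leadingCoeff_mul_prod, norm_mul]
  nth_rewrite 1 [key, ← Complex.norm_mul_exp_arg_mul_I F.leadingCoeff]
  rw [card_roots_eq, rootPhase]
  push_cast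
  ring

theorem exp_mul_I_shift (s : ℝ) (ρ θ : ℝ) :
    Complex.exp (s * Complex.I) * (ρ * Complex.exp (θ * Complex.I)) =
      ρ * Complex.exp (((θ + s : ℝ) : ℂ) * Complex.I) := by
  rw [mul_left_comm, ← Complex.exp_add]
  push_cast
  ring_nf

theorem shiftPlus_circle (lam : ℝ) (F : ℂ[X]) (ρ θ : ℝ) :
    shiftPlus lam F (ρ * Complex.exp (θ * Complex.I)) =
      F.eval (ρ * Complex.exp (((θ + lam / 2 : ℝ) : ℂ) * Complex.I)) := by
  rw [shiftPlus, ← exp_mul_I_shift]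
  congr 3; push_cast; ring

theorem shiftMinus_circle (lam : ℝ) (F : ℂ[X]) (ρ θ : ℝ) :
    shiftMinus lam F (ρ * Complex.exp (θ * Complex.I)) =
      F.eval (ρ * Complex.exp (((θ - lam / 2 : ℝ) : ℂ) * Complex.I)) := by
  rw [shiftMinus, sub_eq_add_neg, ← exp_mul_I_shift]
  congr 3; push_cast; ring

/-- Polar form of the shift quotient: its argument is half the increment of the phase over an arc
of length `lam`. -/
theorem shiftQuotient_circle (lam : ℝ) {F : ℂ[X]} {ρ : ℝ} (hρ : 0 < ρ) (θ : ℝ) :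
    shiftQuotient F.natDegree lam F (ρ * Complex.exp (θ * Complex.I)) =
      ((‖F.eval (ρ * Complex.exp (((θ + lam / 2 : ℝ) : ℂ) * Complex.I))‖ /
        ‖F.eval (ρ * Complex.exp (((θ - lam / 2 : ℝ) : ℂ) * Complex.I))‖ : ℝ) : ℂ) *
      Complex.exp (((rootPhase F ρ (θ + lam / 2) - rootPhase F ρ (θ - lam / 2)) / 2 : ℝ) *
        Complex.I) := by
  rw [shiftQuotient, shiftPlus_circle, shiftMinus_circle]
  nth_rewrite 1 [eval_eq_norm_mul_exp_rootPhase F hρ (θ + lam / 2),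
    eval_eq_norm_mul_exp_rootPhase F hρ (θ - lam / 2)]
  set A := ‖F.eval (ρ * Complex.exp (((θ + lam / 2 : ℝ) : ℂ) * Complex.I))‖
  set B := ‖F.eval (ρ * Complex.exp (((θ - lam / 2 : ℝ) : ℂ) * Complex.I))‖
  set P := rootPhase F ρ (θ + lam / 2)
  set M := rootPhase F ρ (θ - lam / 2)
  have hu := Complex.exp_ne_zero (F.leadingCoeff.arg * Complex.I)
  rw [mul_right_comm (A : ℂ), mul_right_comm (B : ℂ), mul_div_mul_right _ _ hu, mul_div_mul_comm,
    ← Complex.exp_sub, mul_left_comm, ← Complex.exp_add]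
  push_cast
  congr 2
  ring

theorem im_shiftQuotient_circle (lam : ℝ) {F : ℂ[X]} {ρ : ℝ} (hρ : 0 < ρ) (θ : ℝ) :
    (shiftQuotient F.natDegree lam F (ρ * Complex.exp (θ * Complex.I))).im =
      ‖F.eval (ρ * Complex.exp (((θ + lam / 2 : ℝ) : ℂ) * Complex.I))‖ /
        ‖F.eval (ρ * Complex.exp (((θ - lam / 2 : ℝ) : ℂ) * Complex.I))‖ *
      Real.sin ((rootPhase F ρ (θ + lam / 2) - rootPhase F ρ (θ - lam / 2)) / 2) := by
  rw [shiftQuotient_circle lam hρ, Complex.im_ofReal_mul, Complex.exp_ofReal_mul_I_im]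

/-! ### Increments of the phase over arcs of length `lam` -/

/-- If the shift quotient has positive imaginary part on the circle of radius `ρ`, then the phase
increases by less than `2π` over arcs of length `lam`. The increment never equals `2π`, so by
continuity it suffices to exclude that it exceeds `2π` everywhere; in that case `n` arcs of total
length `n * lam < 2π` would have a phase increment of at least the increment `2πn` over the full
circle. -/
theorem rootPhase_sub_lt_of_im_pos {lam : ℝ} {F : ℂ[X]} {ρ : ℝ} (hρ : 0 < ρ)
    (hF : RootsInBall F ρ) (hn : 0 < F.natDegree) (hlt : lam < 2 * Real.pi / F.natDegree)
    (him : ∀ θ : ℝ, 0 <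
      (shiftQuotient F.natDegree lam F (ρ * Complex.exp (θ * Complex.I))).im) (θ : ℝ) :
    rootPhase F ρ (θ + lam) - rootPhase F ρ θ < 2 * Real.pi := by
  have hne : ∀ t, rootPhase F ρ (t + lam) - rootPhase F ρ t ≠ 2 * Real.pi := fun t ht => by
    have h := him (t + lam / 2)
    rw [im_shiftQuotient_circle lam hρ, add_assoc, add_halves, add_sub_cancel_right, ht,
      mul_div_cancel_left₀ _ two_ne_zero, Real.sin_pi, mul_zero] at h
    exact lt_irrefl _ h
  have hcont : Continuous fun t => rootPhase F ρ (t + lam) - rootPhase F ρ t :=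
    ((continuous_rootPhase hF).comp (continuous_add_const lam)).sub (continuous_rootPhase hF)
  by_contra! hge
  by_cases hex : ∃ t, rootPhase F ρ (t + lam) - rootPhase F ρ t ≤ 2 * Real.pi
  · obtain ⟨t, ht⟩ := mem_range_of_exists_le_of_exists_ge hcont hex ⟨θ, hge⟩
    exact hne t ht
  · push Not at hex
    have hiter : ∀ k : ℕ, rootPhase F ρ 0 + k * (2 * Real.pi) ≤ rootPhase F ρ (k * lam) := by
      intro k
      induction k with
      | zero => simp
      | succ k ih =>
        have := hex (k * lam)
        push_cast
        rw [add_mul, one_mul, add_mul, one_mul]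
        linarith
    have h1 := hiter F.natDegree
    have h2 := rootPhase_add_two_pi F ρ 0
    have hn' : (0 : ℝ) < F.natDegree := by exact_mod_cast hn
    rw [lt_div_iff₀ hn'] at hlt
    have h3 := strictMono_rootPhase hF hn (a := F.natDegree * lam) (b := 0 + 2 * Real.pi)
      (by linarith)
    linarith

theorem rootsInBall_of_one_lt {n : ℕ} {F : ℂ[X]} (hF : F ∈ zerosIn n (Metric.closedBall 0 1))
    {ρ : ℝ} (hρ : 1 < ρ) : RootsInBall F ρ := fun a ha => by
  have := hF.2 a (isRoot_of_mem_roots ha)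
  exact norm_div_lt_one (by simpa using this) hρ

theorem rootPhase_sub_lt_of_mem_closedD {n : ℕ} (hn : 0 < n) {lam : ℝ}
    (hlt : lam < 2 * Real.pi / n) {F : ℂ[X]} (hF : F ∈ zerosIn n (Metric.closedBall 0 1))
    (hD : F ∈ closedD n lam) {ρ : ℝ} (hρ : 1 < ρ) (θ : ℝ) :
    rootPhase F ρ (θ + lam) - rootPhase F ρ θ < 2 * Real.pi := by
  obtain rfl : F.natDegree = n := natDegree_eq_of_degree_eq_some hF.1
  refine rootPhase_sub_lt_of_im_pos (by linarith) (rootsInBall_of_one_lt hF hρ) hn hlt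
    (fun t => hD.2 _ ?_) θ
  rwa [norm_mul, Complex.norm_exp_ofReal_mul_I, mul_one, Complex.norm_real,
    Real.norm_of_nonneg (by linarith)]

theorem rootPhase_sub_le_of_mem_closedD {n : ℕ} (hn : 0 < n) {lam : ℝ}
    (hlt : lam < 2 * Real.pi / n) {F : ℂ[X]} (hF : F ∈ zerosIn n (Metric.closedBall 0 1))
    (hD : F ∈ closedD n lam) (h1 : RootsInBall F 1) (θ : ℝ) :
    rootPhase F 1 (θ + lam) - rootPhase F 1 θ ≤ 2 * Real.pi := by
  have ht : ∀ t, Tendsto (fun ρ : ℝ => rootPhase F ρ t) (𝓝[>] 1) (𝓝 (rootPhase F 1 t)) := by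
    intro t
    refine tendsto_multiset_sum _ fun a ha => ?_
    have ha1 : ‖a‖ < 1 := by simpa using h1 a ha
    simpa using tendsto_blaschkePhase_div ha1.le (exp_mul_I_ne_of_norm_lt ha1 t)
  refine le_of_tendsto ((ht _).sub (ht _)) ?_
  filter_upwards [self_mem_nhdsWithin] with ρ hρ
  exact (rootPhase_sub_lt_of_mem_closedD hn hlt hF hD hρ θ).le

/-- Two zeros of a polynomial in `closedD` contribute at most `2π` to the phase increment over an
arc of length `lam`, even if they lie on the unit circle. -/
theorem blaschkePhase_sub_add_sub_le {n : ℕ} (hn : 0 < n) {lam : ℝ} (hpos : 0 < lam)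
    (hlt : lam < 2 * Real.pi / n) {F : ℂ[X]} (hF : F ∈ zerosIn n (Metric.closedBall 0 1))
    (hD : F ∈ closedD n lam) {z w : ℂ} (hzw : ({z, w} : Multiset ℂ) ≤ F.roots) {θ : ℝ}
    (hz₁ : Complex.exp (θ * Complex.I) ≠ z) (hw₁ : Complex.exp (θ * Complex.I) ≠ w)
    (hz₂ : Complex.exp (((θ + lam : ℝ) : ℂ) * Complex.I) ≠ z)
    (hw₂ : Complex.exp (((θ + lam : ℝ) : ℂ) * Complex.I) ≠ w) :
    (blaschkePhase z (θ + lam) - blaschkePhase z θ) +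
      (blaschkePhase w (θ + lam) - blaschkePhase w θ) ≤ 2 * Real.pi := by
  have hnorm : ∀ a ∈ F.roots, ‖a‖ ≤ 1 := fun a ha => by
    simpa using hF.2 a (isRoot_of_mem_roots ha)
  have hz : ‖z‖ ≤ 1 := hnorm z (Multiset.mem_of_le hzw (by simp))
  have hw : ‖w‖ ≤ 1 := hnorm w (Multiset.mem_of_le hzw (by simp))
  refine le_of_tendsto (((tendsto_blaschkePhase_div hz hz₂).sub
    (tendsto_blaschkePhase_div hz hz₁)).add ((tendsto_blaschkePhase_div hw hw₂).sub
    (tendsto_blaschkePhase_div hw hw₁))) ?_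
  filter_upwards [self_mem_nhdsWithin] with ρ hρ
  refine le_trans ?_ (rootPhase_sub_lt_of_mem_closedD hn hlt hF hD hρ θ).le
  obtain ⟨t, ht⟩ := Multiset.le_iff_exists_add.mp hzw
  have hnonneg : 0 ≤ (t.map fun a => blaschkePhase (a / ρ) (θ + lam) -
      blaschkePhase (a / ρ) θ).sum := by
    refine Multiset.sum_nonneg fun x hx => ?_
    obtain ⟨a, ha, rfl⟩ := Multiset.mem_map.mp hx
    have hmem : a ∈ F.roots := by rw [ht]; exact Multiset.mem_add.mpr (Or.inr ha)
    exact sub_nonneg.mpr ((strictMono_blaschkePhase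
      (norm_div_lt_one (hnorm a hmem) hρ)).monotone (by linarith))
  rw [rootPhase, rootPhase, ← Multiset.sum_map_sub, ht, Multiset.map_add, Multiset.sum_add]
  simp only [Multiset.insert_eq_cons, Multiset.map_cons, Multiset.map_singleton,
    Multiset.sum_cons, Multiset.sum_singleton]
  linarith

/-! ### Positivity outside the disk from positivity on the circle -/

theorem reverse_eval_ne_zero {F : ℂ[X]} (hn : 0 < F.natDegree) (h1 : RootsInBall F 1) {w : ℂ}
    (hw : ‖w‖ ≤ 1) : F.reverse.eval w ≠ 0 := fun h => by
  have hF : F ≠ 0 := by rintro rfl; simp at hn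
  by_cases h0 : w = 0
  · rw [h0, ← coeff_zero_eq_eval_zero, coeff_zero_reverse] at h
    exact hF (leadingCoeff_eq_zero.mp h)
  · have := invertibleOfNonzero (inv_ne_zero h0)
    have he := eval₂_reverse_mul_pow (RingHom.id ℂ) w⁻¹ F
    simp only [invOf_eq_inv, inv_inv] at he
    change F.reverse.eval w * _ = F.eval w⁻¹ at he
    rw [h, zero_mul] at he
    have := h1 w⁻¹ ((mem_roots hF).mpr he.symm)
    rw [Complex.ofReal_one, div_one, norm_inv] at this
    exact absurd (one_le_inv₀ (norm_pos_iff.mpr h0) |>.mpr hw) (not_le.mpr this)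

theorem eval_eq_reverse_eval (F : ℂ[X]) {z : ℂ} (hz : z ≠ 0) :
    F.eval z = F.reverse.eval z⁻¹ * z ^ F.natDegree := by
  have := invertibleOfNonzero hz
  have he := eval₂_reverse_mul_pow (RingHom.id ℂ) z F
  rw [invOf_eq_inv] at he
  exact he.symm

/-- The shift quotient in the coordinate `w = 1 / z`, where it extends to the point at infinity. -/
noncomputable def shiftQuotientAtInfty (lam : ℝ) (F : ℂ[X]) (w : ℂ) : ℂ :=
  Complex.exp (Complex.I * F.natDegree * lam / 2) *
    (F.reverse.eval (Complex.exp (-(Complex.I * lam / 2)) * w) /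
      F.reverse.eval (Complex.exp (Complex.I * lam / 2) * w))

theorem norm_exp_I_mul_half (lam : ℝ) : ‖Complex.exp (Complex.I * lam / 2)‖ = 1 := by
  rw [show Complex.I * lam / 2 = ((lam / 2 : ℝ) : ℂ) * Complex.I by push_cast; ring,
    Complex.norm_exp_ofReal_mul_I]

theorem norm_exp_neg_I_mul_half (lam : ℝ) : ‖Complex.exp (-(Complex.I * lam / 2))‖ = 1 := by
  rw [Complex.exp_neg, norm_inv, norm_exp_I_mul_half, inv_one]

theorem shiftQuotient_eq_atInfty (lam : ℝ) (F : ℂ[X]) {z : ℂ} (hz : z ≠ 0) :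
    shiftQuotient F.natDegree lam F z = shiftQuotientAtInfty lam F z⁻¹ := by
  have hp := Complex.exp_ne_zero (Complex.I * lam / 2)
  rw [shiftQuotient, shiftQuotientAtInfty, shiftPlus, shiftMinus,
    eval_eq_reverse_eval F (mul_ne_zero hp hz),
    eval_eq_reverse_eval F (mul_ne_zero (Complex.exp_ne_zero (-(Complex.I * lam / 2))) hz)]
  have e1 : -(Complex.I * F.natDegree * lam / 2) = -(F.natDegree * (Complex.I * lam / 2)) := by
    ring
  have e2 : Complex.I * F.natDegree * lam / 2 = F.natDegree * (Complex.I * lam / 2) := by ring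
  rw [e1, e2]
  simp only [Complex.exp_neg, Complex.exp_nat_mul, mul_inv, inv_inv, mul_pow, inv_pow]
  have hzn := pow_ne_zero F.natDegree hz
  have hpn := pow_ne_zero F.natDegree hp
  generalize eval (Complex.exp (Complex.I * lam / 2) * z⁻¹) F.reverse = B
  generalize eval ((Complex.exp (Complex.I * lam / 2))⁻¹ * z⁻¹) F.reverse = A
  by_cases hB : B = 0
  · simp [hB]
  · field_simp

/-- Maximum principle for the shift quotient of a polynomial with zeros in the open disk. It is
applied to `exp (i G)`, whose modulus is `exp (-Im G)`; equality in the interior is impossible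
because `Im G = sin (n * lam / 2) > 0` at infinity. -/
theorem im_shiftQuotient_pos_of_nonneg {lam : ℝ} (hpos : 0 < lam) {F : ℂ[X]}
    (hn : 0 < F.natDegree) (hlt : lam < 2 * Real.pi / F.natDegree) (h1 : RootsInBall F 1)
    (him : ∀ θ : ℝ, 0 ≤ (shiftQuotient F.natDegree lam F (Complex.exp (θ * Complex.I))).im)
    {z : ℂ} (hz : 1 < ‖z‖) : 0 < (shiftQuotient F.natDegree lam F z).im := by
  set G := shiftQuotientAtInfty lam F with hG
  have hden : ∀ w : ℂ, ‖w‖ ≤ 1 →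
      F.reverse.eval (Complex.exp (Complex.I * lam / 2) * w) ≠ 0 := fun w hw =>
    reverse_eval_ne_zero hn h1 (by rwa [norm_mul, norm_exp_I_mul_half, one_mul])
  have hdiff : ∀ w : ℂ, ‖w‖ ≤ 1 →
      DifferentiableAt ℂ (fun w => Complex.exp (Complex.I * G w)) w := fun w hw => by
    have hd : DifferentiableAt ℂ G w := by
      have hR : ∀ c : ℂ, DifferentiableAt ℂ (fun w => F.reverse.eval (c * w)) w := fun c =>
        DifferentiableAt.comp (g := fun v => F.reverse.eval v) w F.reverse.differentiableAt
          (by fun_prop)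
      exact ((hR _).div (hR _) (hden w hw)).const_mul _
    exact (hd.const_mul _).cexp
  have hnorm : ∀ w : ℂ, ‖Complex.exp (Complex.I * G w)‖ = Real.exp (-(G w).im) := fun w => by
    rw [Complex.norm_exp, Complex.I_mul_re]
  have hcl : DiffContOnCl ℂ (fun w => Complex.exp (Complex.I * G w)) (Metric.ball 0 1) := by
    refine DifferentiableOn.diffContOnCl fun w hw => (hdiff w ?_).differentiableWithinAt
    rw [closure_ball _ one_ne_zero] at hw
    simpa using hw
  have hbound : ∀ w : ℂ, ‖w‖ ≤ 1 → ‖Complex.exp (Complex.I * G w)‖ ≤ 1 := fun w hw => by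
    refine Complex.norm_le_of_forall_mem_frontier_norm_le Metric.isBounded_ball hcl
      (fun v hv => ?_) (z := w) (by rw [closure_ball _ one_ne_zero]; simpa using hw)
    rw [frontier_ball _ one_ne_zero, mem_sphere_zero_iff_norm] at hv
    obtain ⟨t, ht⟩ := (Complex.norm_eq_one_iff v).mp hv
    have hv' : v = (Complex.exp (((-t : ℝ) : ℂ) * Complex.I))⁻¹ := by
      rw [← ht, ← Complex.exp_neg]; push_cast; ring_nf
    rw [hnorm, hG, hv', ← shiftQuotient_eq_atInfty lam F (Complex.exp_ne_zero _),
      Real.exp_le_one_iff, neg_nonpos]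
    exact him (-t)
  have hz0 : z ≠ 0 := by rintro rfl; simp at hz; linarith
  have hw : ‖z⁻¹‖ < 1 := by rw [norm_inv]; exact inv_lt_one_of_one_lt₀ hz
  rw [shiftQuotient_eq_atInfty lam F hz0, ← hG]
  by_contra hneg
  have hmax : IsMaxOn (norm ∘ fun w => Complex.exp (Complex.I * G w)) (Metric.ball 0 1) z⁻¹ := by
    intro v hv
    have hv' : ‖v‖ ≤ 1 := by simpa using (Metric.mem_ball.mp hv).le
    refine (hbound v hv').trans ?_
    change 1 ≤ ‖Complex.exp (Complex.I * G z⁻¹)‖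
    rw [hnorm, Real.one_le_exp_iff]
    linarith
  have heq := Complex.norm_eqOn_of_isPreconnected_of_isMaxOn
    (convex_ball (0 : ℂ) 1).isPreconnected Metric.isOpen_ball hcl.differentiableOn
    (by simpa using hw) hmax (Metric.mem_ball_self one_pos)
  simp only [Function.comp_apply, Function.const_apply, hnorm, Real.exp_eq_exp] at heq
  have hR0 : F.reverse.eval 0 ≠ 0 := reverse_eval_ne_zero hn h1 (by simp)
  have hG0 : (G 0).im = Real.sin (F.natDegree * lam / 2) := by
    rw [hG, shiftQuotientAtInfty, mul_zero, mul_zero, div_self hR0, mul_one,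
      show Complex.I * F.natDegree * lam / 2 = ((F.natDegree * lam / 2 : ℝ) : ℂ) * Complex.I by
        push_cast; ring, Complex.exp_ofReal_mul_I_im]
  have hn' : (0 : ℝ) < F.natDegree := by exact_mod_cast hn
  rw [lt_div_iff₀ hn'] at hlt
  have hs : 0 < Real.sin (F.natDegree * lam / 2) :=
    Real.sin_pos_of_pos_of_lt_pi (by positivity) (by linarith)
  linarith

/-! ### The `n`-inverse and the pencil `F + ζ F^{*n}` -/

theorem nInverse_eval_exp {F : ℂ[X]} {n : ℕ} (hF : F.degree ≤ n) (θ : ℝ) :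
    (nInverse n F).eval (Complex.exp (θ * Complex.I)) = Complex.exp (n * (θ * Complex.I)) *
      starRingEnd ℂ (F.eval (Complex.exp (θ * Complex.I))) := by
  rw [nInverse_eval n F hF _ (Complex.exp_ne_zero _), ← Complex.exp_nat_mul]
  congr 3
  rw [← Complex.exp_conj, map_mul, Complex.conj_ofReal, Complex.conj_I, one_div,
    ← Complex.exp_neg]
  congr 1; ring

theorem degree_nInverse_le (n : ℕ) (F : ℂ[X]) : (nInverse n F).degree ≤ n := by
  refine (degree_sum_le _ _).trans (Finset.sup_le fun k hk => ?_)
  refine (degree_C_mul_X_pow_le _ _).trans ?_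
  exact_mod_cast Nat.lt_succ_iff.mp (Finset.mem_range.mp hk)

theorem nInverse_X_sub_C_mul {w : ℂ} {G : ℂ[X]} {m : ℕ} (hG : G.degree ≤ m) :
    nInverse (m + 1) ((X - C w) * G) = (1 - C (starRingEnd ℂ w) * X) * nInverse m G := by
  refine eq_of_infinite_eval_eq _ _ (Set.Infinite.mono ?_ (Set.finite_singleton 0).infinite_compl)
  intro z hz
  have hz : z ≠ 0 := hz
  have hd : ((X - C w) * G).degree ≤ ((m + 1 : ℕ) : WithBot ℕ) := by
    rw [degree_mul, degree_X_sub_C, add_comm]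
    push_cast
    gcongr
  simp only [Set.mem_ofPred_eq]
  rw [nInverse_eval _ _ hd z hz, eval_mul, eval_mul, nInverse_eval _ _ hG z hz]
  simp only [eval_mul, eval_sub, eval_X, eval_C, eval_one, map_mul, map_sub, map_div₀, map_one,
    Complex.conj_conj]
  field_simp
  ring

/-- If all members of the pencil lie in `closedT`, then `F` has no zero on the unit circle: a
zero `w` there is a zero of the whole pencil, and a double zero for a suitable `ζ`. -/
theorem rootsInBall_one_of_pencil {n : ℕ} (hn : 0 < n) {lam : ℝ} (hpos : 0 < lam) {F : ℂ[X]}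
    (hF : F ∈ zerosIn n (Metric.closedBall 0 1))
    (h : ∀ ζ : ℂ, ‖ζ‖ = 1 → F + C ζ * nInverse n F ∈ closedT n lam) : RootsInBall F 1 := by
  intro w hw
  have hroot := isRoot_of_mem_roots hw
  have hle : ‖w‖ ≤ 1 := by simpa using hF.2 w hroot
  rw [Complex.ofReal_one, div_one]
  refine lt_of_le_of_ne hle fun h1 => ?_
  obtain ⟨t, rfl⟩ := (Complex.norm_eq_one_iff w).mp h1
  set w := Complex.exp (t * Complex.I) with hwdef
  have hw0 : w ≠ 0 := Complex.exp_ne_zero _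
  obtain ⟨G, rfl⟩ := dvd_iff_isRoot.mpr hroot
  obtain ⟨m, rfl⟩ := Nat.exists_eq_succ_of_ne_zero hn.ne'
  have hG : G.degree = m := by
    have := hF.1
    rw [degree_mul, degree_X_sub_C, add_comm, Nat.succ_eq_add_one] at this
    push_cast at this
    exact WithBot.add_right_cancel (by simp) this
  have hconj : starRingEnd ℂ w = w⁻¹ := by
    rw [Complex.inv_def, Complex.normSq_eq_norm_sq, h1]; simp
  have hfac : ∀ ζ, (X - C w) * G + C ζ * nInverse (m + 1) ((X - C w) * G) =
      (X - C w) * (G - C (ζ * w⁻¹) * nInverse m G) := fun ζ => by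
    have hC : (C w : ℂ[X]) * C w⁻¹ = 1 := by rw [← C_mul, mul_inv_cancel₀ hw0, C_1]
    rw [nInverse_X_sub_C_mul hG.le, hconj, C_mul]
    linear_combination (-(C ζ) * nInverse m G) * hC
  -- the parameter `ζ` is chosen so that the second factor vanishes at `w`
  obtain ⟨ζ, hζ, hζw⟩ : ∃ ζ : ℂ, ‖ζ‖ = 1 ∧
      (G - C (ζ * w⁻¹) * nInverse m G).eval w = 0 := by
    have hinv := nInverse_eval_exp hG.le t
    rw [← hwdef] at hinv
    simp only [eval_sub, eval_mul, eval_C]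
    by_cases h0 : G.eval w = 0
    · refine ⟨1, norm_one, ?_⟩
      rw [hinv, h0]; simp
    · have hN : ‖(nInverse m G).eval w‖ = ‖G.eval w‖ := by
        rw [hinv, norm_mul, RCLike.norm_conj, Complex.exp_nat_mul, norm_pow, ← hwdef, h1]; simp
      have hN0 : (nInverse m G).eval w ≠ 0 := by
        rw [← norm_ne_zero_iff, hN]; exact norm_ne_zero_iff.mpr h0
      refine ⟨w * G.eval w / (nInverse m G).eval w, ?_, ?_⟩
      · rw [norm_div, norm_mul, hN, h1, one_mul, div_self (norm_ne_zero_iff.mpr h0)]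
      · field_simp; ring
  have hT := h ζ hζ
  rw [Nat.succ_eq_add_one, hfac] at hT
  have hne : (X - C w) * (G - C (ζ * w⁻¹) * nInverse m G) ≠ 0 := fun h0 => by
    have := hT.1.1
    rw [h0, degree_zero] at this
    exact WithBot.bot_ne_coe this
  have := hT.2 w w (by
    rw [roots_mul hne, roots_X_sub_C, Multiset.insert_eq_cons, ← Multiset.singleton_add]
    refine add_le_add le_rfl (Multiset.singleton_le.mpr ?_)
    exact (mem_roots (right_ne_zero_of_mul hne)).mpr hζw)
  rw [div_self hw0, Complex.arg_one, abs_zero] at this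
  linarith

theorem eval_exp_mul_I_ne_zero {F : ℂ[X]} (hF : F ≠ 0) (h1 : RootsInBall F 1) (θ : ℝ) :
    F.eval (Complex.exp (θ * Complex.I)) ≠ 0 := fun h => by
  have := h1 _ ((mem_roots hF).mpr h)
  simp [Complex.norm_exp_ofReal_mul_I] at this

/-- On the unit circle the zeros of `F + ζ F^{*n}` are the points where the phase takes a certain
value modulo `2π`. -/
theorem pencil_eval_exp_eq_zero_iff {F : ℂ[X]} (hF : F ≠ 0) (h1 : RootsInBall F 1) (ζ : ℂ)
    (θ : ℝ) :
    (F + C ζ * nInverse F.natDegree F).eval (Complex.exp (θ * Complex.I)) = 0 ↔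
      Complex.exp (rootPhase F 1 θ * Complex.I) =
        -ζ * Complex.exp (-(2 * F.leadingCoeff.arg : ℝ) * Complex.I) := by
  have hr0 := eval_exp_mul_I_ne_zero hF h1 θ
  have hpol := eval_eq_norm_mul_exp_rootPhase F one_pos θ
  rw [Complex.ofReal_one, one_mul] at hpol
  set r := ‖F.eval (Complex.exp (θ * Complex.I))‖ with hr
  have hr' : (r : ℂ) ≠ 0 := by simpa [hr] using hr0
  set γ := F.leadingCoeff.arg
  set ψ := rootPhase F 1 θ
  have hconj : ∀ x : ℝ, starRingEnd ℂ (Complex.exp (x * Complex.I)) =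
      Complex.exp (-(x * Complex.I)) := fun x => by
    rw [← Complex.exp_conj, map_mul, Complex.conj_ofReal, Complex.conj_I, mul_neg]
  have key : (F + C ζ * nInverse F.natDegree F).eval (Complex.exp (θ * Complex.I)) =
      r * Complex.exp (((F.natDegree * θ - ψ) / 2 + γ : ℝ) * Complex.I) *
        (Complex.exp (ψ * Complex.I) + ζ * Complex.exp (-(2 * γ : ℝ) * Complex.I)) := by
    rw [eval_add, eval_mul, eval_C, nInverse_eval_exp degree_le_natDegree, hpol, map_mul, map_mul,
      Complex.conj_ofReal, hconj, hconj]
    have e1 : Complex.exp (γ * Complex.I) *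
        Complex.exp (((F.natDegree * θ + ψ) / 2 : ℝ) * Complex.I) =
        Complex.exp (((F.natDegree * θ - ψ) / 2 + γ : ℝ) * Complex.I) *
          Complex.exp (ψ * Complex.I) := by
      rw [← Complex.exp_add, ← Complex.exp_add]; push_cast; ring_nf
    have e2 : Complex.exp (F.natDegree * (θ * Complex.I)) * (Complex.exp (-(γ * Complex.I)) *
        Complex.exp (-(((F.natDegree * θ + ψ) / 2 : ℝ) * Complex.I))) =
        Complex.exp (((F.natDegree * θ - ψ) / 2 + γ : ℝ) * Complex.I) *
          Complex.exp (-(2 * γ : ℝ) * Complex.I) := by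
      rw [← Complex.exp_add, ← Complex.exp_add, ← Complex.exp_add]; push_cast; ring_nf
    linear_combination r * e1 + ζ * r * e2
  rw [key, mul_eq_zero, or_iff_right (mul_ne_zero hr' (Complex.exp_ne_zero _)), neg_mul,
    add_eq_zero_iff_eq_neg, neg_mul]

/-! ### Separation of the zeros of the pencil -/

/-- The zeros on the unit circle of a pencil member are found where the phase passes through
`n` consecutive values differing by `2π`; as there are `n` of them, these are all zeros. -/
theorem pencil_roots {F : ℂ[X]} (hn : 0 < F.natDegree) (h1 : RootsInBall F 1) {ζ : ℂ}
    (hζ : ‖ζ‖ = 1) :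
    F + C ζ * nInverse F.natDegree F ∈ zerosIn F.natDegree (Metric.sphere 0 1) ∧
      (F + C ζ * nInverse F.natDegree F).roots.Nodup := by
  have hF : F ≠ 0 := by rintro rfl; simp at hn
  set n := F.natDegree with hndef
  set H := F + C ζ * nInverse n F with hH
  have hmono := strictMono_rootPhase h1 hn
  obtain ⟨c, hc⟩ := (Complex.norm_eq_one_iff
    (-ζ * Complex.exp (-(2 * F.leadingCoeff.arg : ℝ) * Complex.I))).mp (by
      rw [norm_mul, norm_neg, hζ, neg_mul, norm_exp_neg_mul_I, one_mul])
  have hiff : ∀ θ : ℝ, H.eval (Complex.exp (θ * Complex.I)) = 0 ↔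
      Complex.exp (rootPhase F 1 θ * Complex.I) = Complex.exp (c * Complex.I) := fun θ => by
    rw [hH, hndef, pencil_eval_exp_eq_zero_iff hF h1, hc]
  have hH0 : H ≠ 0 := fun h0 => by
    obtain ⟨θ, hθ⟩ := surjective_rootPhase h1 hn (c + Real.pi)
    have := (hiff θ).mp (by rw [h0, eval_zero])
    rw [hθ] at this
    refine exp_ofReal_mul_I_ne ?_ ?_ this
    · linarith [Real.pi_pos]
    · rw [add_sub_cancel_left, abs_of_pos Real.pi_pos]; linarith [Real.pi_pos]
  choose t ht using fun k : ℕ => surjective_rootPhase h1 hn (c + k * (2 * Real.pi))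
  have htmono : StrictMono t := fun j k hjk => by
    rw [← hmono.lt_iff_lt, ht, ht]
    have : (j : ℝ) < k := by exact_mod_cast hjk
    nlinarith [Real.two_pi_pos]
  have htn : t n = t 0 + 2 * Real.pi := by
    apply hmono.injective
    rw [rootPhase_add_two_pi, ht, ht]
    simp [hndef]
  have hinj : Set.InjOn (fun k => Complex.exp (t k * Complex.I)) (Finset.range n) := by
    intro j hj k hk hjk
    simp only [Finset.coe_range, Set.mem_Iio] at hj hk
    by_contra hne
    refine exp_ofReal_mul_I_ne (fun h => hne (htmono.injective h)) ?_ hjk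
    have a1 := htmono.monotone (Nat.zero_le j)
    have a2 := htmono.monotone (Nat.zero_le k)
    have a3 := htmono hj
    have a4 := htmono hk
    rw [abs_lt]
    constructor <;> linarith
  set S := (Finset.range n).image fun k => Complex.exp (t k * Complex.I) with hS
  have hScard : S.card = n := by rw [hS, Finset.card_image_of_injOn hinj, Finset.card_range]
  have hSle : S.val ≤ H.roots := by
    rw [Multiset.le_iff_subset S.nodup]
    intro z hz
    obtain ⟨k, -, rfl⟩ := Finset.mem_image.mp (Finset.mem_val.mp hz)
    rw [mem_roots hH0, IsRoot.def, hiff, ht, Complex.exp_eq_exp_iff_exists_int]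
    exact ⟨k, by push_cast; ring⟩
  have hdeg : H.degree ≤ n := by
    refine (degree_add_le _ _).trans (max_le degree_le_natDegree ?_)
    refine (degree_mul_le _ _).trans ?_
    calc (C ζ).degree + (nInverse n F).degree ≤ 0 + n :=
          add_le_add degree_C_le (degree_nInverse_le n F)
      _ = n := zero_add _
  have hcard : H.roots.card ≤ n := by
    rw [card_roots_eq]; exact natDegree_le_of_degree_le hdeg
  have hroots : S.val = H.roots :=
    Multiset.eq_of_le_of_card_le hSle (by rw [← Finset.card_def, hScard]; exact hcard)
  refine ⟨⟨?_, fun z hz => ?_⟩, hroots ▸ S.nodup⟩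
  · rw [degree_eq_natDegree hH0, ← card_roots_eq, ← hroots, ← Finset.card_def, hScard]
  · have hmem : z ∈ S.val := hroots ▸ (mem_roots hH0).mpr hz
    obtain ⟨k, -, rfl⟩ := Finset.mem_image.mp (Finset.mem_val.mp hmem)
    simp [Complex.norm_exp_ofReal_mul_I]

theorem eq_exp_add_arg_div {z : ℂ} (hz : ‖z‖ = 1) (α : ℝ) :
    z = Complex.exp (((α + Complex.arg (z / Complex.exp (α * Complex.I)) : ℝ) : ℂ) *
      Complex.I) := by
  have := Complex.norm_mul_exp_arg_mul_I (z / Complex.exp (α * Complex.I))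
  rw [norm_div, hz, Complex.norm_exp_ofReal_mul_I, div_one, Complex.ofReal_one, one_mul,
    eq_div_iff (Complex.exp_ne_zero _), ← Complex.exp_add] at this
  rw [Complex.ofReal_add, add_mul, add_comm, this]

/-- Between two zeros of a pencil member the phase of `F` increases by at least `2π`. -/
theorem exists_two_pi_le_rootPhase_sub {F : ℂ[X]} (hn : 0 < F.natDegree) (h1 : RootsInBall F 1)
    {ζ : ℂ} (hζ : ‖ζ‖ = 1) {z w : ℂ}
    (hzw : ({z, w} : Multiset ℂ) ≤ (F + C ζ * nInverse F.natDegree F).roots) :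
    ∃ θ : ℝ, 2 * Real.pi ≤
      rootPhase F 1 (θ + |Complex.arg (z / w)|) - rootPhase F 1 θ := by
  have hF : F ≠ 0 := by rintro rfl; simp at hn
  obtain ⟨hH, hnodup⟩ := pencil_roots hn h1 hζ
  have hrz := isRoot_of_mem_roots (Multiset.mem_of_le hzw (by simp : z ∈ ({z, w} : Multiset ℂ)))
  have hrw := isRoot_of_mem_roots (Multiset.mem_of_le hzw (by simp : w ∈ ({z, w} : Multiset ℂ)))
  have hzne : z ≠ w := by
    have := Multiset.nodup_of_le hzw hnodup
    simpa using this
  have hz1 : ‖z‖ = 1 := by simpa using hH.2 z hrz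
  have hw1 : ‖w‖ = 1 := by simpa using hH.2 w hrw
  obtain ⟨α, rfl⟩ := (Complex.norm_eq_one_iff w).mp hw1
  set d := Complex.arg (z / Complex.exp (α * Complex.I)) with hd
  have hzd : z = Complex.exp (((α + d : ℝ) : ℂ) * Complex.I) := eq_exp_add_arg_div hz1 α
  have hd0 : d ≠ 0 := fun h => hzne (by rw [hzd, h, add_zero])
  rw [hzd] at hrz
  have e1 := (pencil_eval_exp_eq_zero_iff hF h1 ζ _).mp hrz
  have e2 := (pencil_eval_exp_eq_zero_iff hF h1 ζ _).mp hrw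
  obtain ⟨k, hk⟩ := Complex.exp_eq_exp_iff_exists_int.mp (e1.trans e2.symm)
  have hk' : rootPhase F 1 (α + d) = rootPhase F 1 α + k * (2 * Real.pi) := by
    simpa using congrArg Complex.im hk
  have hmono := strictMono_rootPhase h1 hn
  rcases lt_or_gt_of_ne hd0 with hneg | hpos
  · refine ⟨α + d, ?_⟩
    have hlt := hmono (show α + d < α by linarith)
    have hk0 : k < 0 := by
      by_contra! h
      have : (0 : ℝ) ≤ k := by exact_mod_cast h
      nlinarith [Real.two_pi_pos]
    have : (k : ℝ) ≤ -1 := by exact_mod_cast Int.le_sub_one_of_lt hk0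
    rw [abs_of_neg hneg, add_neg_cancel_right]
    nlinarith [Real.two_pi_pos]
  · refine ⟨α, ?_⟩
    have hlt := hmono (show α < α + d by linarith)
    have hk0 : 0 < k := by
      by_contra! h
      have : (k : ℝ) ≤ 0 := by exact_mod_cast h
      nlinarith [Real.two_pi_pos]
    have : (1 : ℝ) ≤ k := by exact_mod_cast hk0
    rw [abs_of_pos hpos]
    nlinarith [Real.two_pi_pos]

theorem abs_arg_exp_mul_I_le {d : ℝ} (hd : 0 ≤ d) :
    |Complex.arg (Complex.exp (d * Complex.I))| ≤ d := by
  rcases le_or_gt d Real.pi with h | h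
  · rw [Complex.exp_mul_I, Complex.arg_cos_add_sin_mul_I ⟨by linarith [Real.pi_pos], h⟩,
      abs_of_nonneg hd]
  · exact (Complex.abs_arg_le_pi _).trans h.le

/-- If the phase increases by exactly `2π` over an arc, then the endpoints of the arc are zeros of
a common pencil member. -/
theorem exists_pair_of_rootPhase_sub_eq {F : ℂ[X]} (hn : 0 < F.natDegree) (h1 : RootsInBall F 1)
    {θ d : ℝ} (hd : 0 < d) (hd2 : d < 2 * Real.pi)
    (h : rootPhase F 1 (θ + d) - rootPhase F 1 θ = 2 * Real.pi) :
    ∃ ζ : ℂ, ‖ζ‖ = 1 ∧ ∃ z w : ℂ,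
      ({z, w} : Multiset ℂ) ≤ (F + C ζ * nInverse F.natDegree F).roots ∧
        |Complex.arg (z / w)| ≤ d := by
  have hF : F ≠ 0 := by rintro rfl; simp at hn
  set ζ := -Complex.exp (((rootPhase F 1 θ + 2 * F.leadingCoeff.arg : ℝ) : ℂ) * Complex.I)
    with hζdef
  have hζ : ‖ζ‖ = 1 := by rw [hζdef, norm_neg, Complex.norm_exp_ofReal_mul_I]
  have hval : Complex.exp (rootPhase F 1 θ * Complex.I) =
      -ζ * Complex.exp (-(2 * F.leadingCoeff.arg : ℝ) * Complex.I) := by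
    rw [hζdef, neg_neg, ← Complex.exp_add]; push_cast; ring_nf
  have hval' : Complex.exp (rootPhase F 1 (θ + d) * Complex.I) =
      Complex.exp (rootPhase F 1 θ * Complex.I) := by
    rw [Complex.exp_eq_exp_iff_exists_int]
    refine ⟨1, ?_⟩
    rw [show rootPhase F 1 (θ + d) = rootPhase F 1 θ + 2 * Real.pi by linarith]
    push_cast; ring
  obtain ⟨hH, -⟩ := pencil_roots hn h1 hζ
  have hH0 : F + C ζ * nInverse F.natDegree F ≠ 0 := fun h0 => by
    have := hH.1
    rw [h0, degree_zero] at this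
    exact WithBot.bot_ne_coe this
  have hne : Complex.exp (((θ + d : ℝ) : ℂ) * Complex.I) ≠ Complex.exp (θ * Complex.I) :=
    exp_ofReal_mul_I_ne (by linarith) (by rwa [add_sub_cancel_left, abs_of_pos hd])
  refine ⟨ζ, hζ, Complex.exp (((θ + d : ℝ) : ℂ) * Complex.I), Complex.exp (θ * Complex.I), ?_, ?_⟩
  · rw [Multiset.le_iff_subset (by simpa using hne)]
    intro v hv
    rw [mem_roots hH0]
    simp only [Multiset.insert_eq_cons, Multiset.mem_cons, Multiset.mem_singleton] at hv
    rcases hv with rfl | rfl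
    · exact (pencil_eval_exp_eq_zero_iff hF h1 ζ _).mpr (hval'.trans hval)
    · exact (pencil_eval_exp_eq_zero_iff hF h1 ζ _).mpr hval
  · rw [← Complex.exp_sub]
    have : ((θ + d : ℝ) : ℂ) * Complex.I - θ * Complex.I = d * Complex.I := by push_cast; ring
    rw [this]
    exact abs_arg_exp_mul_I_le hd.le

theorem lam_lt_two_pi {n : ℕ} (hn : 0 < n) {lam : ℝ} (hlt : lam < 2 * Real.pi / n) :
    lam < 2 * Real.pi :=
  hlt.trans_le (div_le_self Real.two_pi_pos.le (by exact_mod_cast hn))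

theorem rootPhase_sub_le_iff_pencil {F : ℂ[X]} (hn : 0 < F.natDegree) (h1 : RootsInBall F 1)
    {lam : ℝ} (hpos : 0 < lam) (hlt : lam < 2 * Real.pi) :
    (∀ θ, rootPhase F 1 (θ + lam) - rootPhase F 1 θ ≤ 2 * Real.pi) ↔
      ∀ ζ : ℂ, ‖ζ‖ = 1 → F + C ζ * nInverse F.natDegree F ∈ closedT F.natDegree lam := by
  have hmono := strictMono_rootPhase h1 hn
  constructor
  · intro h ζ hζ
    refine ⟨(pencil_roots hn h1 hζ).1, fun z w hzw => ?_⟩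
    obtain ⟨θ, hθ⟩ := exists_two_pi_le_rootPhase_sub hn h1 hζ hzw
    by_contra! hlt'
    have := hmono (show θ + |Complex.arg (z / w)| < θ + lam by linarith)
    linarith [h θ]
  · intro h θ
    by_contra! hgt
    have hcont : Continuous fun d => rootPhase F 1 (θ + d) - rootPhase F 1 θ :=
      ((continuous_rootPhase h1).comp (continuous_const_add θ)).sub continuous_const
    obtain ⟨d, hd, hd'⟩ := intermediate_value_Ioo hpos.le hcont.continuousOn
      (show 2 * Real.pi ∈ Set.Ioo _ _ from ⟨by simp [Real.pi_pos], hgt⟩)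
    obtain ⟨ζ, hζ, z, w, hzw, harg⟩ := exists_pair_of_rootPhase_sub_eq hn h1 hd.1
      (hd.2.trans hlt) hd'
    linarith [(h ζ hζ).2 z w hzw, hd.2]

theorem openT_subset_closedT (n : ℕ) (lam : ℝ) : openT n lam ⊆ closedT n lam :=
  fun _ h => ⟨h.1, fun z w hzw => (h.2 z w hzw).le⟩

theorem rootPhase_sub_lt_iff_pencil {F : ℂ[X]} (hn : 0 < F.natDegree) (h1 : RootsInBall F 1)
    {lam : ℝ} (hpos : 0 < lam) (hlt : lam < 2 * Real.pi) :
    (∀ θ, rootPhase F 1 (θ + lam) - rootPhase F 1 θ < 2 * Real.pi) ↔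
      ∀ ζ : ℂ, ‖ζ‖ = 1 → F + C ζ * nInverse F.natDegree F ∈ openT F.natDegree lam := by
  have hmono := strictMono_rootPhase h1 hn
  constructor
  · intro h ζ hζ
    refine ⟨(pencil_roots hn h1 hζ).1, fun z w hzw => ?_⟩
    obtain ⟨θ, hθ⟩ := exists_two_pi_le_rootPhase_sub hn h1 hζ hzw
    by_contra! hle
    have := hmono.monotone (show θ + |Complex.arg (z / w)| ≤ θ + lam by linarith)
    linarith [h θ]
  · intro h θ
    refine lt_of_le_of_ne ((rootPhase_sub_le_iff_pencil hn h1 hpos hlt).mpr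
      (fun ζ hζ => openT_subset_closedT _ _ (h ζ hζ)) θ) fun heq => ?_
    obtain ⟨ζ, hζ, z, w, hzw, harg⟩ := exists_pair_of_rootPhase_sub_eq hn h1 hpos hlt heq
    linarith [(h ζ hζ).2 z w hzw]

/-! ### Phase increments and the classes `closedD`, `openD` -/

theorem im_shiftQuotient_circle_nonneg {F : ℂ[X]} (hn : 0 < F.natDegree) (h1 : RootsInBall F 1)
    {lam : ℝ} (hpos : 0 < lam)
    (h : ∀ θ, rootPhase F 1 (θ + lam) - rootPhase F 1 θ ≤ 2 * Real.pi) (θ : ℝ) :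
    0 ≤ (shiftQuotient F.natDegree lam F (Complex.exp (θ * Complex.I))).im := by
  have him := im_shiftQuotient_circle lam (F := F) one_pos θ
  have hinc := h (θ - lam / 2)
  rw [show θ - lam / 2 + lam = θ + lam / 2 by ring] at hinc
  have hlt := strictMono_rootPhase h1 hn (show θ - lam / 2 < θ + lam / 2 by linarith)
  simp only [Complex.ofReal_one, one_mul] at him
  rw [him]
  exact mul_nonneg (by positivity) (Real.sin_nonneg_of_nonneg_of_le_pi (by linarith)
    (by linarith))

theorem mem_closedD_of_rootPhase_sub_le {F : ℂ[X]} (hn : 0 < F.natDegree) (h1 : RootsInBall F 1)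
    {lam : ℝ} (hpos : 0 < lam) (hlt : lam < 2 * Real.pi / F.natDegree)
    (h : ∀ θ, rootPhase F 1 (θ + lam) - rootPhase F 1 θ ≤ 2 * Real.pi) :
    F ∈ closedD F.natDegree lam :=
  ⟨degree_eq_natDegree (by rintro rfl; simp at hn), fun _ hz =>
    im_shiftQuotient_pos_of_nonneg hpos hn hlt h1
      (im_shiftQuotient_circle_nonneg hn h1 hpos h) hz⟩

theorem rootPhase_sub_lt_iff_im_pos {F : ℂ[X]} (hn : 0 < F.natDegree) (h1 : RootsInBall F 1)
    {lam : ℝ} (hpos : 0 < lam) (hlt : lam < 2 * Real.pi / F.natDegree) :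
    (∀ θ, rootPhase F 1 (θ + lam) - rootPhase F 1 θ < 2 * Real.pi) ↔
      ∀ z : ℂ, 1 ≤ ‖z‖ → 0 < (shiftQuotient F.natDegree lam F z).im := by
  have hF : F ≠ 0 := by rintro rfl; simp at hn
  constructor
  · intro h z hz
    rcases hz.lt_or_eq with hz | hz
    · exact (mem_closedD_of_rootPhase_sub_le hn h1 hpos hlt fun θ => (h θ).le).2 z hz
    · obtain ⟨θ, rfl⟩ := (Complex.norm_eq_one_iff z).mp hz.symm
      have him := im_shiftQuotient_circle lam (F := F) one_pos θ
      have hinc := h (θ - lam / 2)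
      rw [show θ - lam / 2 + lam = θ + lam / 2 by ring] at hinc
      have hmono := strictMono_rootPhase h1 hn (show θ - lam / 2 < θ + lam / 2 by linarith)
      simp only [Complex.ofReal_one, one_mul] at him
      rw [him]
      exact mul_pos (div_pos (norm_pos_iff.mpr (eval_exp_mul_I_ne_zero hF h1 _))
        (norm_pos_iff.mpr (eval_exp_mul_I_ne_zero hF h1 _)))
        (Real.sin_pos_of_pos_of_lt_pi (by linarith) (by linarith))
  · intro h
    exact rootPhase_sub_lt_of_im_pos one_pos h1 hn hlt fun θ => h _ (by
      rw [Complex.ofReal_one, one_mul, Complex.norm_exp_ofReal_mul_I])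

theorem notMem_closedT_of_rootsInBall {n : ℕ} (hn : 0 < n) {F : ℂ[X]} (hdeg : F.natDegree = n)
    (h1 : RootsInBall F 1) (lam : ℝ) : F ∉ closedT n lam := fun h => by
  subst hdeg
  obtain ⟨a, ha⟩ := Multiset.card_pos_iff_exists_mem.mp ((card_roots_eq F).symm ▸ hn)
  have h2 : ‖a‖ = 1 := by simpa using h.1.2 a (isRoot_of_mem_roots ha)
  have h3 := h1 a ha
  simp [h2] at h3

/-- A polynomial in `closedD` with a zero on the unit circle lies in `closedT`. A zero on the
circle uses up the whole phase increment `2π` available on the arc of length `lam` centred at it,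
which leaves no room for zeros in the open disk, and two zeros at a distance less than `lam` would
produce an increment of `4π`. -/
theorem mem_closedT_of_mem_closedD {n : ℕ} (hn : 0 < n) {lam : ℝ} (hpos : 0 < lam)
    (hlt : lam < 2 * Real.pi / n) {F : ℂ[X]} (hF : F ∈ zerosIn n (Metric.closedBall 0 1))
    (hD : F ∈ closedD n lam) {w : ℂ} (hw : w ∈ F.roots) (hw1 : ‖w‖ = 1) :
    F ∈ closedT n lam := by
  have hlam := lam_lt_two_pi hn hlt
  have hF0 : F ≠ 0 := (mem_roots'.mp hw).1
  have hcirc : ∀ a ∈ F.roots, ‖a‖ = 1 := by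
    intro a ha
    have hle : ‖a‖ ≤ 1 := by simpa using hF.2 a (isRoot_of_mem_roots ha)
    refine le_antisymm hle (not_lt.mp fun ha1 => ?_)
    have hne : w ≠ a := by rintro rfl; linarith
    obtain ⟨α, rfl⟩ := (Complex.norm_eq_one_iff w).mp hw1
    have hpair : ({Complex.exp (α * Complex.I), a} : Multiset ℂ) ≤ F.roots := by
      rw [Multiset.le_iff_subset (by simpa using hne)]
      intro v hv
      simp only [Multiset.insert_eq_cons, Multiset.mem_cons, Multiset.mem_singleton] at hv
      rcases hv with rfl | rfl <;> assumption
    have hle := blaschkePhase_sub_add_sub_le hn hpos hlt hF hD hpair (θ := α - lam / 2)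
      (exp_ofReal_mul_I_ne (by linarith) (by rw [abs_lt]; constructor <;> linarith))
      (exp_mul_I_ne_of_norm_lt ha1 _)
      (exp_ofReal_mul_I_ne (by linarith) (by rw [abs_lt]; constructor <;> linarith))
      (exp_mul_I_ne_of_norm_lt ha1 _)
    rw [blaschkePhase_exp_sub (by linarith) (by linarith) (by linarith) (by linarith)] at hle
    have := strictMono_blaschkePhase ha1 (show α - lam / 2 < α - lam / 2 + lam by linarith)
    linarith
  refine ⟨⟨hF.1, fun z hz => ?_⟩, fun z v hzv => ?_⟩
  · simpa using hcirc z ((mem_roots hF0).mpr hz)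
  · by_contra! hd
    have hz1 := hcirc z (Multiset.mem_of_le hzv (by simp))
    have hv1 := hcirc v (Multiset.mem_of_le hzv (by simp))
    obtain ⟨α, rfl⟩ := (Complex.norm_eq_one_iff v).mp hv1
    set d := Complex.arg (z / Complex.exp (α * Complex.I)) with hddef
    have hzd : z = Complex.exp (((α + d : ℝ) : ℂ) * Complex.I) := eq_exp_add_arg_div hz1 α
    clear_value d
    subst hzd
    obtain ⟨hd1, hd2⟩ := abs_lt.mp hd
    -- the arc of length `lam` with the same midpoint as the two zeros
    have hle := blaschkePhase_sub_add_sub_le hn hpos hlt hF hD hzv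
      (θ := α + d / 2 - lam / 2)
      (exp_ofReal_mul_I_ne (by linarith) (by rw [abs_lt]; constructor <;> linarith))
      (exp_ofReal_mul_I_ne (by linarith) (by rw [abs_lt]; constructor <;> linarith))
      (exp_ofReal_mul_I_ne (by linarith) (by rw [abs_lt]; constructor <;> linarith))
      (exp_ofReal_mul_I_ne (by linarith) (by rw [abs_lt]; constructor <;> linarith))
    rw [blaschkePhase_exp_sub (by linarith) (by linarith) (by linarith) (by linarith),
      blaschkePhase_exp_sub (by linarith) (by linarith) (by linarith) (by linarith)] at hle
    linarith [Real.pi_pos]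

theorem rootsInBall_one_of_mem_closedD_diff {n : ℕ} (hn : 0 < n) {lam : ℝ} (hpos : 0 < lam)
    (hlt : lam < 2 * Real.pi / n) {F : ℂ[X]} (hF : F ∈ zerosIn n (Metric.closedBall 0 1))
    (h : F ∈ closedD n lam \ closedT n lam) : RootsInBall F 1 := fun a ha => by
  have hle : ‖a‖ ≤ 1 := by simpa using hF.2 a (isRoot_of_mem_roots ha)
  rw [Complex.ofReal_one, div_one]
  exact lt_of_le_of_ne hle fun h1 =>
    h.2 (mem_closedT_of_mem_closedD hn hpos hlt hF h.1 ha h1)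

/-- A zero `w` of `F` on the unit circle would give the value `0` of the shift quotient at
`e^{-i lam/2} w`. -/
theorem rootsInBall_one_of_im_pos {n : ℕ} {lam : ℝ} {F : ℂ[X]}
    (hF : F ∈ zerosIn n (Metric.closedBall 0 1))
    (h : ∀ z : ℂ, 1 ≤ ‖z‖ → 0 < (shiftQuotient n lam F z).im) : RootsInBall F 1 := fun a ha => by
  have hroot := isRoot_of_mem_roots ha
  have hle : ‖a‖ ≤ 1 := by simpa using hF.2 a hroot
  rw [Complex.ofReal_one, div_one]
  refine lt_of_le_of_ne hle fun h1 => ?_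
  have := h (Complex.exp (-(Complex.I * lam / 2)) * a) (by
    rw [norm_mul, norm_exp_neg_I_mul_half, h1, one_mul])
  rw [shiftQuotient, shiftPlus, ← mul_assoc, ← Complex.exp_add, add_neg_cancel,
    Complex.exp_zero, one_mul, hroot.eq_zero, zero_div, mul_zero, Complex.zero_im] at this
  exact lt_irrefl _ this

/-! ### Boundary values of the shift quotients of the pencil -/

theorem hasDerivAt_eval_const_mul (P : ℂ[X]) (c z : ℂ) :
    HasDerivAt (fun v => P.eval (c * v)) (c * (derivative P).eval (c * z)) z := by
  have h : HasDerivAt (fun v : ℂ => c * v) c z := by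
    simpa using (hasDerivAt_id z).const_mul c
  have := (P.hasDerivAt (c * z)).comp z h
  rwa [mul_comm] at this

/-- On the unit circle, the combination `e^{-i n lam/2} H_+ - x H_-` for a pencil member `H`,
written in terms of the shift quotient `f` of `F`. The shift quotient of `F^{*n}` is the complex
conjugate of `f` there. -/
theorem pencil_shift_combination {F : ℂ[X]} (hF : F ≠ 0) (h1 : RootsInBall F 1) (lam x : ℝ)
    (ζ : ℂ) (θ : ℝ) :
    Complex.exp (-(Complex.I * F.natDegree * lam / 2)) *
        shiftPlus lam (F + C ζ * nInverse F.natDegree F) (Complex.exp (θ * Complex.I)) -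
      x * shiftMinus lam (F + C ζ * nInverse F.natDegree F) (Complex.exp (θ * Complex.I)) =
    (shiftQuotient F.natDegree lam F (Complex.exp (θ * Complex.I)) - x) *
        shiftMinus lam F (Complex.exp (θ * Complex.I)) +
      ζ * ((starRingEnd ℂ (shiftQuotient F.natDegree lam F (Complex.exp (θ * Complex.I))) - x) *
        shiftMinus lam (nInverse F.natDegree F) (Complex.exp (θ * Complex.I))) := by
  have hp := fun P : ℂ[X] => shiftPlus_circle lam P 1 θ
  have hm := fun P : ℂ[X] => shiftMinus_circle lam P 1 θ
  simp only [Complex.ofReal_one, one_mul] at hp hm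
  have hm0 := eval_exp_mul_I_ne_zero hF h1 (θ - lam / 2)
  have hm0' := (map_ne_zero (starRingEnd ℂ)).mpr hm0
  rw [shiftQuotient, hp, hp, hm, hm, hm, eval_add, eval_add, eval_mul, eval_mul, eval_C, eval_C,
    nInverse_eval_exp degree_le_natDegree, nInverse_eval_exp degree_le_natDegree]
  set A := F.eval (Complex.exp (((θ + lam / 2 : ℝ) : ℂ) * Complex.I))
  set B := F.eval (Complex.exp (((θ - lam / 2 : ℝ) : ℂ) * Complex.I))
  have hc : starRingEnd ℂ (Complex.exp (-(Complex.I * F.natDegree * lam / 2))) =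
      Complex.exp (Complex.I * F.natDegree * lam / 2) := by
    rw [← Complex.exp_conj]
    simp only [map_neg, map_div₀, map_mul, Complex.conj_I, Complex.conj_ofReal, map_natCast,
      map_ofNat]
    congr 1; ring
  have e1 : Complex.exp (-(Complex.I * F.natDegree * lam / 2)) *
      Complex.exp (F.natDegree * (((θ + lam / 2 : ℝ) : ℂ) * Complex.I)) =
      Complex.exp (Complex.I * F.natDegree * lam / 2) *
        Complex.exp (F.natDegree * (((θ - lam / 2 : ℝ) : ℂ) * Complex.I)) := by
    rw [← Complex.exp_add, ← Complex.exp_add]; push_cast; ring_nf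
  rw [map_mul, map_div₀, hc]
  generalize Complex.exp (-(Complex.I * F.natDegree * lam / 2)) = E at e1 ⊢
  generalize Complex.exp (Complex.I * F.natDegree * lam / 2) = E' at e1 ⊢
  generalize Complex.exp (F.natDegree * (((θ + lam / 2 : ℝ) : ℂ) * Complex.I)) = P at e1 ⊢
  generalize Complex.exp (F.natDegree * (((θ - lam / 2 : ℝ) : ℂ) * Complex.I)) = M at e1 ⊢
  field_simp
  linear_combination ζ * starRingEnd ℂ A * e1

/-- At a boundary point where the shift quotient of `F` is real, the shift quotients of all pencil
members have the same limit. There the imaginary part of the shift quotient `f` has a minimum along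
the circle, so `f` has a real tangential derivative; hence `e^{-i n lam/2} H_+ - x H_-` vanishes
to second order whenever `H_-`, whose zeros are simple, vanishes. -/
theorem tendsto_shiftQuotient_pencil {F : ℂ[X]} (hn : 0 < F.natDegree) (h1 : RootsInBall F 1)
    {lam : ℝ} (hpos : 0 < lam)
    (h : ∀ θ, rootPhase F 1 (θ + lam) - rootPhase F 1 θ ≤ 2 * Real.pi) {z₀ : ℂ} (hz₀ : ‖z₀‖ = 1)
    {x : ℝ} (hx : shiftQuotient F.natDegree lam F z₀ = x) {ζ : ℂ} (hζ : ‖ζ‖ = 1) :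
    Tendsto (shiftQuotient F.natDegree lam (F + C ζ * nInverse F.natDegree F)) (𝓝[≠] z₀)
      (𝓝 (x : ℂ)) := by
  have hF : F ≠ 0 := by rintro rfl; simp at hn
  obtain ⟨θ₀, rfl⟩ := (Complex.norm_eq_one_iff z₀).mp hz₀
  obtain ⟨hH, hnodup⟩ := pencil_roots hn h1 hζ
  have hcomb := pencil_shift_combination hF h1 lam x ζ
  set n := F.natDegree
  set H := F + C ζ * nInverse n F with hHdef
  have hH0 : H ≠ 0 := fun h0 => by
    have := hH.1
    rw [h0, degree_zero] at this
    exact WithBot.bot_ne_coe this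
  set p := Complex.exp (Complex.I * lam / 2) with hp
  set q := Complex.exp (-(Complex.I * lam / 2)) with hq
  set e := Complex.exp (-(Complex.I * n * lam / 2)) with he
  set z₀ := Complex.exp (θ₀ * Complex.I) with hz₀def
  set D : ℂ → ℂ := fun z => e * shiftPlus lam H z - x * shiftMinus lam H z with hD
  have hDderiv : HasDerivAt D (e * (p * (derivative H).eval (p * z₀)) -
      x * (q * (derivative H).eval (q * z₀))) z₀ :=
    ((hasDerivAt_eval_const_mul H p z₀).const_mul e).sub
      ((hasDerivAt_eval_const_mul H q z₀).const_mul (x : ℂ))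
  have hMderiv : HasDerivAt (shiftMinus lam H) (q * (derivative H).eval (q * z₀)) z₀ :=
    hasDerivAt_eval_const_mul H q z₀
  set D' := e * (p * (derivative H).eval (p * z₀)) - x * (q * (derivative H).eval (q * z₀))
  have hQ : ∀ z, shiftMinus lam H z ≠ 0 →
      shiftQuotient n lam H z = x + D z / shiftMinus lam H z := fun z hz => by
    rw [shiftQuotient, hD]
    field_simp
    ring
  have hD0 : D z₀ = 0 := by
    rw [hD]
    simp only [hz₀def, hcomb]
    rw [← hz₀def, hx, Complex.conj_ofReal]
    ring
  by_cases hM0 : shiftMinus lam H z₀ = 0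
  · -- the derivative of `D` along the circle is `f' * H_-`, where `f'` is real
    have hcircle : HasDerivAt (fun v : ℂ => Complex.exp (v * Complex.I)) (z₀ * Complex.I) θ₀ := by
      simpa using ((hasDerivAt_id (θ₀ : ℂ)).mul_const Complex.I).cexp
    have hm0 : shiftMinus lam F z₀ ≠ 0 := by
      have := shiftMinus_circle lam F 1 θ₀
      simp only [Complex.ofReal_one, one_mul] at this
      rw [hz₀def, this]
      exact eval_exp_mul_I_ne_zero hF h1 _
    have hQderiv : ∃ Q', HasDerivAt (shiftQuotient n lam F) Q' z₀ :=
      ⟨_, ((hasDerivAt_eval_const_mul F p z₀).div (hasDerivAt_eval_const_mul F q z₀)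
        hm0).const_mul e⟩
    obtain ⟨Q', hQ'⟩ := hQderiv
    have hf := (hQ'.comp (θ₀ : ℂ) hcircle).comp_ofReal
    have hA := ((hasDerivAt_eval_const_mul F q z₀).comp (θ₀ : ℂ) hcircle).comp_ofReal
    have hB := ((hasDerivAt_eval_const_mul (nInverse n F) q z₀).comp (θ₀ : ℂ)
      hcircle).comp_ofReal
    have hd := (hDderiv.comp (θ₀ : ℂ) hcircle).comp_ofReal
    set f' := Q' * (z₀ * Complex.I)
    have hf'im : f'.im = 0 := by
      have him := Complex.imCLM.hasFDerivAt.comp_hasDerivAt θ₀ hf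
      refine IsLocalMin.hasDerivAt_eq_zero (Eventually.of_forall fun t => ?_) him
      change (shiftQuotient n lam F z₀).im ≤
        (shiftQuotient n lam F (Complex.exp (t * Complex.I))).im
      rw [hx, Complex.ofReal_im]
      exact im_shiftQuotient_circle_nonneg hn h1 hpos h t
    have hf'conj : starRingEnd ℂ f' = f' := Complex.conj_eq_iff_im.mpr hf'im
    have hfc : HasDerivAt _ (starRingEnd ℂ f') θ₀ :=
      Complex.conjCLE.hasFDerivAt.comp_hasDerivAt θ₀ hf
    rw [hf'conj] at hfc
    have hprod := ((hf.sub_const (x : ℂ)).mul hA).add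
      (((hfc.sub_const (x : ℂ)).mul hB).const_mul ζ)
    have hprod' := hprod.congr_of_eventuallyEq (f₁ := fun t : ℝ =>
      (D ∘ fun v : ℂ => Complex.exp (v * Complex.I)) t) (Eventually.of_forall fun t => hcomb t)
    have hD'eq := hd.unique hprod'
    have hsum : F.eval (q * z₀) + ζ * (nInverse n F).eval (q * z₀) = 0 := by
      rw [← hM0, shiftMinus, hHdef, eval_add, eval_mul, eval_C]
    simp only [Function.comp_apply, ← hz₀def, hx, Complex.conjCLE_apply, Complex.conj_ofReal,
      sub_self, zero_mul, add_zero] at hD'eq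
    have hD'0 : D' = 0 := by
      have hz : z₀ * Complex.I ≠ 0 := mul_ne_zero (Complex.exp_ne_zero _) Complex.I_ne_zero
      refine (mul_eq_zero.mp (?_ : D' * (z₀ * Complex.I) = 0)).resolve_right hz
      rw [hD'eq]
      linear_combination f' * hsum
    have hsimple : q * (derivative H).eval (q * z₀) ≠ 0 := by
      refine mul_ne_zero (Complex.exp_ne_zero _) fun hder => ?_
      have hcount := Multiset.nodup_iff_count_le_one.mp hnodup (q * z₀)
      rw [count_roots] at hcount
      exact absurd ((one_lt_rootMultiplicity_iff_isRoot hH0).mpr ⟨hM0, hder⟩)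
        (not_lt.mpr hcount)
    have hlim := (hasDerivAt_iff_tendsto_slope.mp hDderiv).div
      (hasDerivAt_iff_tendsto_slope.mp hMderiv) hsimple
    rw [hD'0, zero_div] at hlim
    have hlim' := hlim.const_add (x : ℂ)
    rw [add_zero] at hlim'
    refine hlim'.congr' ?_
    filter_upwards [hMderiv.eventually_ne hsimple (c := 0), self_mem_nhdsWithin] with z hz hzne
    have hzne' : z - z₀ ≠ 0 := sub_ne_zero.mpr hzne
    rw [hQ z hz, Pi.div_apply, slope_def_field, slope_def_field, hD0, hM0, sub_zero, sub_zero,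
      div_div_div_cancel_right₀ hzne']
  · have hcont := (hDderiv.continuousAt.div hMderiv.continuousAt hM0).tendsto.const_add (x : ℂ)
    simp only [Pi.div_apply, hD0, zero_div, add_zero] at hcont
    refine (hcont.mono_left nhdsWithin_le_nhds).congr' ?_
    filter_upwards [nhdsWithin_le_nhds (hMderiv.continuousAt.eventually_ne hM0)] with z hz
    exact (hQ z hz).symm

theorem mainTheorem3 (n : ℕ) (hn : 0 < n) (lam : ℝ) (hlam_pos : 0 < lam)
    (hlam_lt : lam < 2 * Real.pi / n) (F : ℂ[X])
    (hF : F ∈ zerosIn n (Metric.closedBall 0 1)) :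
    (F ∈ closedD n lam \ closedT n lam ↔
      ∀ ζ : ℂ, ‖ζ‖ = 1 → F + C ζ * nInverse n F ∈ closedT n lam) ∧
    (F ∈ openD n lam \ openT n lam ↔
      ∀ ζ : ℂ, ‖ζ‖ = 1 → F + C ζ * nInverse n F ∈ openT n lam) ∧
    (F ∈ closedD n lam \ closedT n lam →
      ∀ z₀ : ℂ, ‖z₀‖ = 1 → ∀ x : ℝ, shiftQuotient n lam F z₀ = (x : ℂ) →
        ∀ ζ : ℂ, ‖ζ‖ = 1 →
          Tendsto (shiftQuotient n lam (F + C ζ * nInverse n F)) (𝓝[≠] z₀) (𝓝 (x : ℂ))) := by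
  have hlam := lam_lt_two_pi hn hlam_lt
  have hball := fun h => rootsInBall_one_of_mem_closedD_diff hn hlam_pos hlam_lt hF h
  have hle := fun hD => rootPhase_sub_le_of_mem_closedD hn hlam_lt hF hD
  have hpencil := rootsInBall_one_of_pencil hn hlam_pos hF
  obtain rfl : F.natDegree = n := natDegree_eq_of_degree_eq_some hF.1
  refine ⟨⟨fun h => ?_, fun h => ?_⟩, ⟨fun h => ?_, fun h => ?_⟩, fun h z₀ hz₀ x hx ζ hζ => ?_⟩
  · exact (rootPhase_sub_le_iff_pencil hn (hball h) hlam_pos hlam).mp (hle h.1 (hball h))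
  · have h1 := hpencil h
    exact ⟨mem_closedD_of_rootPhase_sub_le hn h1 hlam_pos hlam_lt
      ((rootPhase_sub_le_iff_pencil hn h1 hlam_pos hlam).mpr h),
      notMem_closedT_of_rootsInBall hn rfl h1 lam⟩
  · have him := (h.1.resolve_left h.2).2
    have h1 := rootsInBall_one_of_im_pos hF him
    exact (rootPhase_sub_lt_iff_pencil hn h1 hlam_pos hlam).mp
      ((rootPhase_sub_lt_iff_im_pos hn h1 hlam_pos hlam_lt).mpr him)
  · have h1 := hpencil fun ζ hζ => openT_subset_closedT _ _ (h ζ hζ)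
    exact ⟨Or.inr ⟨hF.1, (rootPhase_sub_lt_iff_im_pos hn h1 hlam_pos hlam_lt).mp
      ((rootPhase_sub_lt_iff_pencil hn h1 hlam_pos hlam).mpr h)⟩, fun hT =>
      notMem_closedT_of_rootsInBall hn rfl h1 lam (openT_subset_closedT _ _ hT)⟩
  · exact tendsto_shiftQuotient_pencil hn (hball h) hlam_pos (hle h.1 (hball h)) hz₀ hx hζ
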